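/- **Theorem (Prym–Euler).** Let $g\ge 0$ be an integer. Consider polynomials with indeterminate coefficients, in case (I) $$u(x)=x^{2g}+u_1x^{2g-2}+\cdots+u_g,\quad v(x)=v_1x^{2g-1}+v_2x^{2g-3}+\cdots+v_gx,\quad w(x)=x^{2g+2}+w_1x^{2g}+\cdots+w_{g+1},$$ and in case (II) $$u(x)=x^{2g+1}+u_1x^{2g-1}+\cdots+u_gx,\quad v(x)=v_1x^{2g}+v_2x^{2g-2}+\cdots+v_{g+1},\quad w(x)=x^{2g+3}+w_1x^{2g+1}+\cdots+w_{g+1}x.$$ Let $\mathcal A$ be the polynomial ring over $\mathbb C$ in all the $u_i,v_i,w_i$. The commuting derivations $D_1,\dots,D_g$ of $\mathcal A$ are defined by $$D(x_2)u(x_1)=\frac{x_2u(x_1)v(x_2)-x_1v(x_1)u(x_2)}{x_1^2-x_2^2},\qquad D(x_2)v(x_1)=\frac{x_1}{2}\Bigl(\frac{w(x_1)u(x_2)-u(x_1)w(x_2)}{x_1^2-x_2^2}-u(x_1)u(x_2)\Bigr),$$ $$D(x_2)w(x_1)=\frac{x_1v(x_1)w(x_2)-x_2w(x_1)v(x_2)}{x_1^2-x_2^2}+x_1v(x_1)u(x_2),$$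 where $D(x)=\sum_{i=1}^g x^{2(g-i)}D_i$ in case (I) and $D(x)=\sum_{i=1}^g x^{2(g-i)+1}D_i$ in case (II). Put $f_0=x^{4g+2}$ in case (I) and $f_0=x^{4g+4}$ in case (II), and let $\mathcal A_0$ be the quotient of $\mathcal A$ by the relation $u(x)w(x)+v(x)^2=f_0(x)$ (by the coefficients of all powers of $x$ in the difference of both sides); the $D_i$ descend to $\mathcal A_0$. Let $C_0^{*''}$ be the complex $0\to C_0^0\to\cdots\to C_0^g\to 0$ in which $C_0^k$ is the $k$-th exterior power of the free $\mathcal A_0$-module with basis $dt_1,\dots,dt_g$, with differential $d=\sum_i dt_i\wedge D_i$. Grade it by $\deg u_i=\deg v_i=\deg w_i=i$ and $\deg dt_i=-i$. Then the homogeneous parts of every $C_0^k$ are finite dimensional and vanish in all sufficiently low degrees, and the $q$-Euler characteristic $$\chi_q(C_0^{*''})=\sum_{k=0}^g(-1)^k\sum_{m\in\mathbb Z}q^m\dim (C_0^k)^{(m)}$$ is, as a formal Laurent series in $q$, the expansion of $$(-1)^gq^{-g(g+1)/2}\frac{[2g+1]_q!}{[g]_q!\,[g+1]_q!}\ \text{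 in case (I)},\qquad (-1)^gq^{-g(g+1)/2}\frac{[2g+2]_q!}{[g+1]_q!\,[g+1]_q!}\ \text{ in case (II)},$$ where $[k]_q!=\prod_{i=1}^k(1-q^i)$. As $q\to1$ these rational functions of $q\in\mathbb C$ tend to $(-1)^g\binom{2g+1}{g}$ and $(-1)^g\binom{2g+2}{g+1}$, respectively. -/

import Mathlib

open Polynomial

namespace HyperellipticPrym

noncomputable section

/-! ### Phase space, Lax polynomials and vector fields -/

/-- The two types of hyperelliptic Prym systems. -/
inductive PrymType where
  | I
  | II

/-- The parity `ε` of the exponents of `u(x)`: `0` in case (I), `1` in case (II). -/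
def PrymType.eps : PrymType → ℕ
  | .I => 0
  | .II => 1

/-- The coordinates of the phase space, indexed from `0`: `u j`, `v j`, `w j` are the coordinates
`u_{j+1}`, `v_{j+1}`, `w_{j+1}`. There are `g` of the first kind, `g` (case (I)) or `g+1`
(case (II)) of the second, and `g+1` of the third. -/
inductive Coord (c : PrymType) (g : ℕ) where
  | u (j : Fin g)
  | v (j : Fin (g + c.eps))
  | w (j : Fin (g + 1))

/-- The grading: `u_i`, `v_i`, `w_i` have degree `i`. -/
def Coord.deg {c : PrymType} {g : ℕ} : Coord c g → ℕ
  | .u j => j + 1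
  | .v j => j + 1
  | .w j => j + 1

/-- The affine ring `𝒜` of the phase space. -/
abbrev PhaseRing (c : PrymType) (g : ℕ) : Type := MvPolynomial (Coord c g) ℂ

variable (c : PrymType) (g : ℕ)

/-- `u(x) = x^{2g} + u_1 x^{2g-2} + ⋯ + u_g` in case (I),
`u(x) = x^{2g+1} + u_1 x^{2g-1} + ⋯ + u_g x` in case (II). -/
def uPoly : (PhaseRing c g)[X] :=
  X ^ (2 * g + c.eps) +
    ∑ j : Fin g, C (MvPolynomial.X (Coord.u j)) * X ^ (2 * (g - (j + 1)) + c.eps)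

/-- `v(x) = v_1 x^{2g-1} + v_2 x^{2g-3} + ⋯ + v_g x` in case (I),
`v(x) = v_1 x^{2g} + v_2 x^{2g-2} + ⋯ + v_{g+1}` in case (II). -/
def vPoly : (PhaseRing c g)[X] :=
  ∑ j : Fin (g + c.eps),
    C (MvPolynomial.X (Coord.v j)) * X ^ (2 * (g + c.eps - (j + 1)) + (1 - c.eps))

/-- `w(x) = x^{2g+2} + w_1 x^{2g} + ⋯ + w_{g+1}` in case (I),
`w(x) = x^{2g+3} + w_1 x^{2g+1} + ⋯ + w_{g+1} x` in case (II). -/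
def wPoly : (PhaseRing c g)[X] :=
  X ^ (2 * (g + 1) + c.eps) +
    ∑ j : Fin (g + 1), C (MvPolynomial.X (Coord.w j)) * X ^ (2 * (g + 1 - (j + 1)) + c.eps)

section Evolution

variable {R : Type} [CommRing R]

/-- The variable `x₁` of the polynomial ring `R[x₂][x₁]`. -/
abbrev x₁ : R[X][X] := X

/-- The variable `x₂` of the polynomial ring `R[x₂][x₁]`. -/
abbrev x₂ : R[X][X] := C X

/-- `p(x₁) ∈ R[x₂][x₁]`. -/
abbrev at₁ (p : R[X]) : R[X][X] := p.map C

/-- `p(x₂) ∈ R[x₂][x₁]`. -/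
abbrev at₂ (p : R[X]) : R[X][X] := C p

/-- `D(x₂)u(x₁) = (x₂ u(x₁) v(x₂) - x₁ v(x₁) u(x₂)) / (x₁² - x₂²)`. (Here and below, the numerator
is a multiple of the denominator, which is monic in `x₁`.) -/
def Du (u v : R[X]) : R[X][X] :=
  (x₂ * at₁ u * at₂ v - x₁ * at₁ v * at₂ u) /ₘ (x₁ ^ 2 - x₂ ^ 2)

/-- `D(x₂)v(x₁) = (x₁/2) ((w(x₁) u(x₂) - u(x₁) w(x₂)) / (x₁² - x₂²) - u(x₁) u(x₂))`. -/
def Dv [Algebra ℂ R] (u w : R[X]) : R[X][X] :=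
  C (C (algebraMap ℂ R (1 / 2))) * x₁ *
    ((at₁ w * at₂ u - at₁ u * at₂ w) /ₘ (x₁ ^ 2 - x₂ ^ 2) - at₁ u * at₂ u)

/-- `D(x₂)w(x₁) = (x₁ v(x₁) w(x₂) - x₂ w(x₁) v(x₂)) / (x₁² - x₂²) + x₁ v(x₁) u(x₂)`. -/
def Dw (u v w : R[X]) : R[X][X] :=
  (x₁ * at₁ v * at₂ w - x₂ * at₁ w * at₂ v) /ₘ (x₁ ^ 2 - x₂ ^ 2) + x₁ * at₁ v * at₂ u

end Evolution

/-- The vector field `D_{i+1}`, where `D(x) = ∑_{i=1}^g x^{2(g-i)} D_i` in case (I) and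
`D(x) = ∑_{i=1}^g x^{2(g-i)+1} D_i` in case (II): its value at a coordinate is the coefficient of
`D(x₂)u(x₁)`, `D(x₂)v(x₁)` or `D(x₂)w(x₁)` at the power of `x₂` that belongs to `D_{i+1}` and the
power of `x₁` that belongs to the coordinate. -/
def vectorField (i : Fin g) : Derivation ℂ (PhaseRing c g) (PhaseRing c g) :=
  MvPolynomial.mkDerivation ℂ fun y => match y with
    | .u j => ((Du (uPoly c g) (vPoly c g)).coeff (2 * (g - (j + 1)) + c.eps)).coeff (2 * (g - (i + 1)) + c.eps)
    | .v j => ((Dv (uPoly c g) (wPoly c g)).coeff (2 * (g + c.eps - (j + 1)) + (1 - c.eps))).coeff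
        (2 * (g - (i + 1)) + c.eps)
    | .w j => ((Dw (uPoly c g) (vPoly c g) (wPoly c g)).coeff (2 * (g + 1 - (j + 1)) + c.eps)).coeff (2 * (g - (i + 1)) + c.eps)

/-! ### Level sets -/

/-- The ideal of `𝒜` given by the relation `u(x) w(x) + v(x)² = f(x)`. -/
def levelIdeal (f : ℂ[X]) : Ideal (PhaseRing c g) :=
  Ideal.span (Set.range fun n : ℕ =>
    (uPoly c g * wPoly c g + vPoly c g ^ 2 - f.map MvPolynomial.C).coeff n)

/-- The affine ring `𝒜_f` of the level set over `f`. -/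
abbrev LevelRing (f : ℂ[X]) : Type := PhaseRing c g ⧸ levelIdeal c g f

/-! ### The vector fields commute and preserve the level sets -/

section Proofs

section Generic

variable {R : Type} [CommRing R]

/-- The span of the monomials `x^{2k+e}`, `k ≤ m`. -/
def polyOf (R : Type) [CommRing R] (m e : ℕ) : AddSubgroup R[X] :=
  AddSubgroup.closure {p | ∃ k a, k ≤ m ∧ p = C a * X ^ (2 * k + e)}

/-- The span of the monomials `x₂^{2i+e₂} x₁^{2j+e₁}`, `i < m`, `j < n`. -/
def biOf (R : Type) [CommRing R] (m e₂ n e₁ : ℕ) : AddSubgroup R[X][X] :=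
  AddSubgroup.closure {p | ∃ i j a, i < m ∧ j < n ∧
    p = C (C a * X ^ (2 * i + e₂)) * X ^ (2 * j + e₁)}

lemma monic_den : (x₁ ^ 2 - x₂ ^ 2 : R[X][X]).Monic := by
  have : (x₁ ^ 2 - x₂ ^ 2 : R[X][X]) = X ^ 2 - C (X ^ 2) := by simp
  rw [this]
  exact monic_X_pow_sub_C _ (by norm_num)

lemma bez_mono_aux {m e k l : ℕ} (hl : l ≤ k) (hk : k ≤ m) (a : R) :
    ∃ s ∈ biOf R m e m e, C (C a) * (x₁ ^ (2 * k + e) * x₂ ^ (2 * l + e)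
        - x₁ ^ (2 * l + e) * x₂ ^ (2 * k + e)) = (x₁ ^ 2 - x₂ ^ 2) * s := by
  obtain ⟨d, hd⟩ := Nat.exists_eq_add_of_le hl
  subst hd
  refine ⟨∑ t ∈ Finset.range d,
    C (C a * X ^ (2 * (l + (d - 1 - t)) + e)) * X ^ (2 * (l + t) + e), ?_, ?_⟩
  · refine AddSubgroup.sum_mem _ fun t ht => AddSubgroup.subset_closure
      ⟨l + (d - 1 - t), l + t, a, ?_, ?_, rfl⟩
    all_goals have := Finset.mem_range.1 ht; omega
  · have h := geom_sum₂_mul (x₁ ^ 2 : R[X][X]) (x₂ ^ 2) d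
    have : ∑ t ∈ Finset.range d,
        C (C a * X ^ (2 * (l + (d - 1 - t)) + e)) * X ^ (2 * (l + t) + e)
        = C (C a) * (x₁ * x₂) ^ (2 * l + e) *
          ∑ t ∈ Finset.range d, (x₁ ^ 2 : R[X][X]) ^ t * (x₂ ^ 2) ^ (d - 1 - t) := by
      rw [Finset.mul_sum]
      refine Finset.sum_congr rfl fun t _ => ?_
      simp only [C_mul, C_pow]
      ring
    rw [this]
    linear_combination (-C (C a) * (x₁ * x₂) ^ (2 * l + e)) * h

lemma bez_mono {m e k l : ℕ} (hl : l ≤ m) (hk : k ≤ m) (a : R) :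
    ∃ s ∈ biOf R m e m e, C (C a) * (x₁ ^ (2 * k + e) * x₂ ^ (2 * l + e)
        - x₁ ^ (2 * l + e) * x₂ ^ (2 * k + e)) = (x₁ ^ 2 - x₂ ^ 2) * s := by
  rcases le_total l k with h | h
  · exact bez_mono_aux h hk a
  · obtain ⟨s, hs, he⟩ := bez_mono_aux (e := e) h hl a
    exact ⟨-s, neg_mem hs, by linear_combination -he⟩

lemma bez {m e : ℕ} {p q : R[X]} (hp : p ∈ polyOf R m e) (hq : q ∈ polyOf R m e) :
    ∃ s ∈ biOf R m e m e, at₁ p * at₂ q - at₁ q * at₂ p = (x₁ ^ 2 - x₂ ^ 2) * s := by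
  induction hp, hq using AddSubgroup.closure_induction₂ with
  | mem p q hp hq =>
    obtain ⟨k, a, hk, rfl⟩ := hp
    obtain ⟨l, b, hl, rfl⟩ := hq
    obtain ⟨s, hs, he⟩ := bez_mono (e := e) hl hk (a * b)
    refine ⟨s, hs, ?_⟩
    rw [← he]
    simp only [at₁, at₂, Polynomial.map_mul, map_C, Polynomial.map_pow, map_X, C_mul, C_pow]
    ring
  | zero_left q _ => exact ⟨0, zero_mem _, by simp⟩
  | zero_right q _ => exact ⟨0, zero_mem _, by simp⟩
  | add_left p q r _ _ _ h1 h2 =>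
    obtain ⟨s, hs, he⟩ := h1
    obtain ⟨t, ht, hf⟩ := h2
    refine ⟨s + t, add_mem hs ht, ?_⟩
    simp only [at₁, at₂, Polynomial.map_add, C_add] at *
    linear_combination he + hf
  | add_right p q r _ _ _ h1 h2 =>
    obtain ⟨s, hs, he⟩ := h1
    obtain ⟨t, ht, hf⟩ := h2
    refine ⟨s + t, add_mem hs ht, ?_⟩
    simp only [at₁, at₂, Polynomial.map_add, C_add] at *
    linear_combination he + hf
  | neg_left p q _ _ h =>
    obtain ⟨s, hs, he⟩ := h
    refine ⟨-s, neg_mem hs, ?_⟩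
    simp only [at₁, at₂, Polynomial.map_neg, C_neg] at *
    linear_combination -he
  | neg_right p q _ _ h =>
    obtain ⟨s, hs, he⟩ := h
    refine ⟨-s, neg_mem hs, ?_⟩
    simp only [at₁, at₂, Polynomial.map_neg, C_neg] at *
    linear_combination -he

lemma biOf_shift {m e₂ n e₁ n' e₁' k : ℕ} (a : R)
    (h : ∀ j < n, ∃ j' < n', 2 * j + e₁ + k = 2 * j' + e₁')
    {s : R[X][X]} (hs : s ∈ biOf R m e₂ n e₁) :
    C (C a) * X ^ k * s ∈ biOf R m e₂ n' e₁' := by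
  induction hs using AddSubgroup.closure_induction with
  | mem p hp =>
    obtain ⟨i, j, b, hi, hj, rfl⟩ := hp
    obtain ⟨j', hj', he⟩ := h j hj
    refine AddSubgroup.subset_closure ⟨i, j', a * b, hi, hj', ?_⟩
    rw [← he]
    simp only [C_mul, C_pow]
    ring
  | zero => simp
  | add p q _ _ hp hq => rw [mul_add]; exact add_mem hp hq
  | neg p _ hp =>
    have h' : C (C a) * X ^ k * -p = -(C (C a) * X ^ k * p) := by ring
    rw [h']
    exact neg_mem hp

lemma biOf_eval {m e₂ n e₁ : ℕ} {s : R[X][X]} (hs : s ∈ biOf R m e₂ n e₁) (a b : R) :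
    s.evalEval a b = ∑ j : Fin n, ∑ i : Fin m,
      (s.coeff (2 * (n - (j + 1)) + e₁)).coeff (2 * (m - (i + 1)) + e₂) *
        a ^ (2 * (m - (i + 1)) + e₂) * b ^ (2 * (n - (j + 1)) + e₁) := by
  have key : s.evalEval a b = ∑ j ∈ Finset.range n, ∑ i ∈ Finset.range m,
      (s.coeff (2 * j + e₁)).coeff (2 * i + e₂) * a ^ (2 * i + e₂) * b ^ (2 * j + e₁) := by
    induction hs using AddSubgroup.closure_induction with
    | mem p hp =>
      obtain ⟨i, j, d, hi, hj, rfl⟩ := hp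
      rw [Finset.sum_eq_single_of_mem j (Finset.mem_range.2 hj),
        Finset.sum_eq_single_of_mem i (Finset.mem_range.2 hi)]
      · rw [coeff_C_mul, coeff_X_pow, if_pos rfl, mul_one, coeff_C_mul, coeff_X_pow, if_pos rfl]
        simp [evalEval]
      · intro i' _ hne
        rw [coeff_C_mul, coeff_X_pow, if_pos rfl, mul_one, coeff_C_mul, coeff_X_pow,
          if_neg (by omega)]
        simp
      · intro j' _ hne
        refine Finset.sum_eq_zero fun i' _ => ?_
        rw [coeff_C_mul, coeff_X_pow, if_neg (by omega)]
        simp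
    | zero => simp
    | add p q _ _ hp hq =>
      rw [evalEval_add, hp, hq]
      simp only [coeff_add, add_mul, Finset.sum_add_distrib]
    | neg p _ hp =>
      rw [evalEval_neg, hp]
      simp only [coeff_neg, neg_mul, Finset.sum_neg_distrib]
  rw [key, ← Finset.sum_range_reflect, Finset.sum_range]
  refine Finset.sum_congr rfl fun j _ => ?_
  rw [← Finset.sum_range_reflect, Finset.sum_range]
  refine Finset.sum_congr rfl fun i _ => ?_
  simp only [Nat.sub_sub, Nat.add_comm 1]

variable {m e : ℕ} {u v w : R[X]}

lemma Du_spec (hu : u ∈ polyOf R m e) (hv : X * v ∈ polyOf R m e) :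
    Du u v ∈ biOf R m e m e ∧
    (x₁ ^ 2 - x₂ ^ 2) * Du u v = x₂ * at₁ u * at₂ v - x₁ * at₁ v * at₂ u := by
  obtain ⟨s, hs, he⟩ := bez hu hv
  have h : x₂ * at₁ u * at₂ v - x₁ * at₁ v * at₂ u = (x₁ ^ 2 - x₂ ^ 2) * s := by
    rw [← he]
    simp only [at₁, at₂, Polynomial.map_mul, map_X, C_mul]
    ring
  have : Du u v = s := by rw [Du, h, mul_divByMonic_cancel_left _ monic_den]
  rw [this]
  exact ⟨hs, h.symm⟩

lemma Dv_spec [Algebra ℂ R] (he1 : e ≤ 1) (hu : u ∈ polyOf R m e)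
    (hw : w - X ^ 2 * u ∈ polyOf R m e) :
    Dv u w ∈ biOf R m e (m + e) (1 - e) ∧
    2 * (x₁ ^ 2 - x₂ ^ 2) * Dv u w = x₁ * (at₁ w * at₂ u - at₁ u * at₂ w
      - (x₁ ^ 2 - x₂ ^ 2) * at₁ u * at₂ u) := by
  obtain ⟨s, hs, he⟩ := bez hw hu
  have h : at₁ w * at₂ u - at₁ u * at₂ w = (x₁ ^ 2 - x₂ ^ 2) * (s + at₁ u * at₂ u) := by
    simp only [at₁, at₂, Polynomial.map_mul, Polynomial.map_sub, Polynomial.map_pow, map_X, C_mul,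
      C_sub, C_pow] at *
    linear_combination he
  have hD : Dv u w = C (C (algebraMap ℂ R (1 / 2))) * X ^ 1 * s := by
    rw [Dv, h, mul_divByMonic_cancel_left _ monic_den]
    ring
  have h2 : (2 : R[X][X]) * C (C (algebraMap ℂ R (1 / 2))) = 1 := by
    have h1 : algebraMap ℂ R (1 / 2) + algebraMap ℂ R (1 / 2) = 1 := by
      rw [← map_add, ← map_one (algebraMap ℂ R)]
      norm_num
    rw [two_mul, ← C_add, ← C_add, h1, C_1, C_1]
  refine ⟨?_, ?_⟩
  · rw [hD]
    refine biOf_shift _ (fun j hj => ?_) hs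
    exact ⟨j + e, by omega, by omega⟩
  · rw [hD, h]
    linear_combination (x₁ ^ 2 - x₂ ^ 2) * x₁ * s * h2

lemma Dw_spec (hu : u ∈ polyOf R m e) (hv : X * v ∈ polyOf R m e)
    (hw : w - X ^ 2 * u ∈ polyOf R m e) :
    Dw u v w ∈ biOf R m e (m + 1) e ∧
    (x₁ ^ 2 - x₂ ^ 2) * Dw u v w = x₁ * at₁ v * at₂ w - x₂ * at₁ w * at₂ v
      + (x₁ ^ 2 - x₂ ^ 2) * x₁ * at₁ v * at₂ u := by
  obtain ⟨s, hs, he⟩ := bez hv hw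
  obtain ⟨t, ht, hf⟩ := bez hv hu
  have h : x₁ * at₁ v * at₂ w - x₂ * at₁ w * at₂ v
      = (x₁ ^ 2 - x₂ ^ 2) * (s + x₁ ^ 2 * t - x₁ * at₁ v * at₂ u) := by
    simp only [at₁, at₂, Polynomial.map_mul, Polynomial.map_sub, Polynomial.map_pow, map_X, C_mul,
      C_sub, C_pow] at *
    linear_combination he + x₁ ^ 2 * hf
  have hD : Dw u v w = C (C 1) * X ^ 0 * s + C (C 1) * X ^ 2 * t := by
    rw [Dw, h, mul_divByMonic_cancel_left _ monic_den]
    rw [show (C (C (1 : R)) : R[X][X]) = 1 by simp]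
    ring
  refine ⟨?_, ?_⟩
  · rw [hD]
    refine add_mem (biOf_shift _ (fun j hj => ⟨j, by omega, by omega⟩) hs)
      (biOf_shift _ (fun j hj => ⟨j + 1, by omega, by omega⟩) ht)
  · rw [hD, h]
    rw [show (C (C (1 : R)) : R[X][X]) = 1 by simp]
    ring

lemma Du_eval (hu : u ∈ polyOf R m e) (hv : X * v ∈ polyOf R m e) (a b : R) :
    (b ^ 2 - a ^ 2) * (Du u v).evalEval a b
      = a * u.eval b * v.eval a - b * v.eval b * u.eval a := by
  have h := congrArg (evalEvalRingHom a b) (Du_spec hu hv).2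
  simp only [map_mul, map_sub, map_pow, coe_evalEvalRingHom, evalEval_C, evalEval_map_C,
    evalEval_X, eval_X] at h
  exact h

lemma Dv_eval [Algebra ℂ R] (he1 : e ≤ 1) (hu : u ∈ polyOf R m e)
    (hw : w - X ^ 2 * u ∈ polyOf R m e) (a b : R) :
    2 * (b ^ 2 - a ^ 2) * (Dv u w).evalEval a b = b * (w.eval b * u.eval a - u.eval b * w.eval a
      - (b ^ 2 - a ^ 2) * u.eval b * u.eval a) := by
  have h := congrArg (evalEvalRingHom a b) (Dv_spec he1 hu hw).2
  simp only [map_mul, map_sub, map_pow, map_ofNat, coe_evalEvalRingHom, evalEval_C, evalEval_map_C,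
    evalEval_X, eval_X] at h
  exact h

lemma Dw_eval (hu : u ∈ polyOf R m e) (hv : X * v ∈ polyOf R m e)
    (hw : w - X ^ 2 * u ∈ polyOf R m e) (a b : R) :
    (b ^ 2 - a ^ 2) * (Dw u v w).evalEval a b = b * v.eval b * w.eval a - a * w.eval b * v.eval a
      + (b ^ 2 - a ^ 2) * b * v.eval b * u.eval a := by
  have h := congrArg (evalEvalRingHom a b) (Dw_spec hu hv hw).2
  simp only [map_mul, map_sub, map_add, map_pow, coe_evalEvalRingHom, evalEval_C, evalEval_map_C,
    evalEval_X, eval_X] at h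
  exact h

end Generic

variable {c g}

lemma eps_le (c : PrymType) : c.eps ≤ 1 := by cases c <;> simp [PrymType.eps]

lemma u_mem : uPoly c g ∈ polyOf (PhaseRing c g) g c.eps := by
  refine add_mem (AddSubgroup.subset_closure ⟨g, 1, le_rfl, by simp⟩)
    (AddSubgroup.sum_mem _ fun j _ => AddSubgroup.subset_closure ⟨_, _, ?_, rfl⟩)
  omega

lemma xv_mem : X * vPoly c g ∈ polyOf (PhaseRing c g) g c.eps := by
  rw [vPoly, Finset.mul_sum]
  refine AddSubgroup.sum_mem _ fun j _ =>
    AddSubgroup.subset_closure ⟨g - j, MvPolynomial.X (Coord.v j), by omega, ?_⟩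
  have : 2 * (g - (j : ℕ)) + c.eps = 2 * (g + c.eps - (j + 1)) + (1 - c.eps) + 1 := by
    have := j.2
    have := eps_le c
    omega
  rw [this]
  ring

lemma w_mem : wPoly c g - X ^ 2 * uPoly c g ∈ polyOf (PhaseRing c g) g c.eps := by
  have h : X ^ 2 * ∑ j : Fin g, C (MvPolynomial.X (Coord.u j)) * X ^ (2 * (g - (j + 1)) + c.eps)
      = ∑ j : Fin g, C (MvPolynomial.X (Coord.u j) : PhaseRing c g)
          * X ^ (2 * (g - j) + c.eps) := by
    rw [Finset.mul_sum]
    refine Finset.sum_congr rfl fun j _ => ?_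
    have : 2 * (g - (j : ℕ)) + c.eps = 2 * (g - (j + 1)) + c.eps + 2 := by omega
    rw [this]
    ring
  have h' : wPoly c g - X ^ 2 * uPoly c g =
      (∑ j : Fin (g + 1), C (MvPolynomial.X (Coord.w j)) * X ^ (2 * (g + 1 - (j + 1)) + c.eps))
      - ∑ j : Fin g, C (MvPolynomial.X (Coord.u j)) * X ^ (2 * (g - j) + c.eps) := by
    rw [← h, wPoly, uPoly]
    ring
  rw [h']
  refine sub_mem (AddSubgroup.sum_mem _ fun j _ => AddSubgroup.subset_closure ⟨_, _, ?_, rfl⟩)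
    (AddSubgroup.sum_mem _ fun j _ => AddSubgroup.subset_closure ⟨_, _, ?_, rfl⟩) <;> omega

/-- `D(a) = ∑ a^{2(g-i)+ε} D_i` for a number `a`. -/
def vfAt (c : PrymType) (g : ℕ) (a : ℂ) : Derivation ℂ (PhaseRing c g) (PhaseRing c g) :=
  ∑ i : Fin g, a ^ (2 * (g - (i + 1)) + c.eps) • vectorField c g i

lemma vfAt_apply (a : ℂ) (y : PhaseRing c g) : vfAt c g a y =
    ∑ i : Fin g, a ^ (2 * (g - (i + 1)) + c.eps) • vectorField c g i y := by
  rw [vfAt, ← Derivation.coeFnAddMonoidHom_apply, map_sum, Finset.sum_apply]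
  rfl

/-- The value of a polynomial at a number. -/
def valAt (b : ℂ) (p : (PhaseRing c g)[X]) : PhaseRing c g := p.eval (MvPolynomial.C b)

lemma smul_eq (b : ℂ) (y : PhaseRing c g) : b • y = MvPolynomial.C b * y :=
  MvPolynomial.smul_eq_C_mul _ _

lemma der_C (E : Derivation ℂ (PhaseRing c g) (PhaseRing c g)) (b : ℂ) :
    E (MvPolynomial.C b) = 0 := E.map_algebraMap b

lemma der_C_mul (E : Derivation ℂ (PhaseRing c g) (PhaseRing c g)) (b : ℂ) (y : PhaseRing c g) :
    E (MvPolynomial.C b * y) = MvPolynomial.C b * E y := by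
  rw [E.leibniz, der_C]; simp

lemma der_C_pow_mul (E : Derivation ℂ (PhaseRing c g) (PhaseRing c g)) (b : ℂ) (n : ℕ)
    (y : PhaseRing c g) :
    E (y * MvPolynomial.C b ^ n) = MvPolynomial.C b ^ n * E y := by
  rw [← MvPolynomial.C_pow, mul_comm, der_C_mul]

lemma der_u (E : Derivation ℂ (PhaseRing c g) (PhaseRing c g)) (b : ℂ) :
    E (valAt b (uPoly c g)) = ∑ j : Fin g,
      MvPolynomial.C b ^ (2 * (g - (j + 1)) + c.eps) * E (MvPolynomial.X (Coord.u j)) := by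
  simp only [valAt, uPoly, eval_add, eval_finsetSum, eval_mul, eval_pow, eval_X, eval_C, map_add,
    map_sum, der_C_pow_mul]
  rw [← MvPolynomial.C_pow, der_C, zero_add]

lemma der_v (E : Derivation ℂ (PhaseRing c g) (PhaseRing c g)) (b : ℂ) :
    E (valAt b (vPoly c g)) = ∑ j : Fin (g + c.eps),
      MvPolynomial.C b ^ (2 * (g + c.eps - (j + 1)) + (1 - c.eps)) *
        E (MvPolynomial.X (Coord.v j)) := by
  simp only [valAt, vPoly, eval_finsetSum, eval_mul, eval_pow, eval_X, eval_C,
    map_sum, der_C_pow_mul]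

lemma der_w (E : Derivation ℂ (PhaseRing c g) (PhaseRing c g)) (b : ℂ) :
    E (valAt b (wPoly c g)) = ∑ j : Fin (g + 1),
      MvPolynomial.C b ^ (2 * (g + 1 - (j + 1)) + c.eps) * E (MvPolynomial.X (Coord.w j)) := by
  simp only [valAt, wPoly, eval_add, eval_finsetSum, eval_mul, eval_pow, eval_X, eval_C, map_add,
    map_sum, der_C_pow_mul]
  rw [← MvPolynomial.C_pow, der_C, zero_add]

lemma vf_u (a b : ℂ) : vfAt c g a (valAt b (uPoly c g)) =
    (Du (uPoly c g) (vPoly c g)).evalEval (MvPolynomial.C a) (MvPolynomial.C b) := by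
  rw [der_u, biOf_eval (Du_spec u_mem xv_mem).1]
  refine Finset.sum_congr rfl fun j _ => ?_
  rw [vfAt_apply, Finset.mul_sum]
  refine Finset.sum_congr rfl fun i _ => ?_
  rw [smul_eq, vectorField, MvPolynomial.mkDerivation_X, MvPolynomial.C_pow]
  ring

lemma vf_v (a b : ℂ) : vfAt c g a (valAt b (vPoly c g)) =
    (Dv (uPoly c g) (wPoly c g)).evalEval (MvPolynomial.C a) (MvPolynomial.C b) := by
  rw [der_v, biOf_eval (Dv_spec (eps_le c) u_mem w_mem).1]
  refine Finset.sum_congr rfl fun j _ => ?_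
  rw [vfAt_apply, Finset.mul_sum]
  refine Finset.sum_congr rfl fun i _ => ?_
  rw [smul_eq, vectorField, MvPolynomial.mkDerivation_X, MvPolynomial.C_pow]
  ring

lemma vf_w (a b : ℂ) : vfAt c g a (valAt b (wPoly c g)) =
    (Dw (uPoly c g) (vPoly c g) (wPoly c g)).evalEval (MvPolynomial.C a) (MvPolynomial.C b) := by
  rw [der_w, biOf_eval (Dw_spec u_mem xv_mem w_mem).1]
  refine Finset.sum_congr rfl fun j _ => ?_
  rw [vfAt_apply, Finset.mul_sum]
  refine Finset.sum_congr rfl fun i _ => ?_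
  rw [smul_eq, vectorField, MvPolynomial.mkDerivation_X, MvPolynomial.C_pow]
  ring

lemma evol_u (a b : ℂ) :
    ((MvPolynomial.C b : PhaseRing c g) ^ 2 - MvPolynomial.C a ^ 2) *
      vfAt c g a (valAt b (uPoly c g)) =
    MvPolynomial.C a * valAt b (uPoly c g) * valAt a (vPoly c g)
      - MvPolynomial.C b * valAt b (vPoly c g) * valAt a (uPoly c g) := by
  rw [vf_u, Du_eval u_mem xv_mem]; rfl

lemma evol_v (a b : ℂ) :
    2 * ((MvPolynomial.C b : PhaseRing c g) ^ 2 - MvPolynomial.C a ^ 2) *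
      vfAt c g a (valAt b (vPoly c g)) =
    MvPolynomial.C b * (valAt b (wPoly c g) * valAt a (uPoly c g)
      - valAt b (uPoly c g) * valAt a (wPoly c g)
      - (MvPolynomial.C b ^ 2 - MvPolynomial.C a ^ 2) * valAt b (uPoly c g)
        * valAt a (uPoly c g)) := by
  rw [vf_v, Dv_eval (eps_le c) u_mem w_mem]; rfl

lemma evol_w (a b : ℂ) :
    ((MvPolynomial.C b : PhaseRing c g) ^ 2 - MvPolynomial.C a ^ 2) *
      vfAt c g a (valAt b (wPoly c g)) =
    MvPolynomial.C b * valAt b (vPoly c g) * valAt a (wPoly c g)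
      - MvPolynomial.C a * valAt b (wPoly c g) * valAt a (vPoly c g)
      + (MvPolynomial.C b ^ 2 - MvPolynomial.C a ^ 2) * MvPolynomial.C b * valAt b (vPoly c g)
        * valAt a (uPoly c g) := by
  rw [vf_w, Dw_eval u_mem xv_mem w_mem]; rfl

/-- A polynomial identity in `b` that holds for almost all `b` holds coefficientwise. -/
lemma vand {n : ℕ} (e : Fin n → ℕ) (he : Function.Injective e) (y : Fin n → PhaseRing c g)
    (S : Set ℂ) (hS : S.Finite)
    (h : ∀ b ∉ S, ∑ j, MvPolynomial.C b ^ e j * y j = 0) (j : Fin n) : y j = 0 := by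
  have h0 : (∑ j, C (y j) * X ^ e j : (PhaseRing c g)[X]) = 0 := by
    refine eq_zero_of_infinite_isRoot _ ?_
    refine (hS.infinite_compl.image (f := fun b => (MvPolynomial.C b : PhaseRing c g))
      (MvPolynomial.C_injective _ _).injOn).mono ?_
    rintro _ ⟨b, hb, rfl⟩
    rw [Set.mem_ofPred_eq, IsRoot, ← h b hb]
    simp only [eval_finsetSum, eval_mul, eval_C, eval_pow, eval_X]
    exact Finset.sum_congr rfl fun j _ => mul_comm _ _
  have h1 := congrArg (fun p => p.coeff (e j)) h0
  simpa [coeff_X_pow, he.eq_iff, finsetSum_coeff] using h1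

/-- The finite set of numbers with square `a²`. -/
def bad (a : ℂ) : Set ℂ := {a, -a}

lemma bad_finite (a : ℂ) : (bad a).Finite := by simp [bad]

lemma ne_of_not_bad {a b : ℂ} (h : b ∉ bad a) :
    (MvPolynomial.C b : PhaseRing c g) ^ 2 - MvPolynomial.C a ^ 2 ≠ 0 := by
  rw [← MvPolynomial.C_pow, ← MvPolynomial.C_pow, sub_ne_zero]
  intro h'
  exact h (by simpa [bad] using sq_eq_sq_iff_eq_or_eq_neg.1 (MvPolynomial.C_injective _ _ h'))

lemma exp_inj (n e : ℕ) : Function.Injective fun j : Fin n => 2 * (n - ((j : ℕ) + 1)) + e := by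
  intro i j h
  have := i.2
  have := j.2
  ext
  dsimp only at h
  omega

lemma der_eq_zero (E : Derivation ℂ (PhaseRing c g) (PhaseRing c g)) (S : Set ℂ) (hS : S.Finite)
    (hu : ∀ b ∉ S, E (valAt b (uPoly c g)) = 0) (hv : ∀ b ∉ S, E (valAt b (vPoly c g)) = 0)
    (hw : ∀ b ∉ S, E (valAt b (wPoly c g)) = 0) (y : Coord c g) :
    E (MvPolynomial.X y) = 0 := by
  cases y with
  | u j =>
    exact vand (fun j => 2 * (g - (j + 1)) + c.eps) (exp_inj _ _)
      (fun j => E (MvPolynomial.X (Coord.u j))) S hS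
      (fun b hb => by rw [← der_u, hu b hb]) j
  | v j =>
    exact vand (fun j => 2 * (g + c.eps - (j + 1)) + (1 - c.eps)) (exp_inj _ _)
      (fun j => E (MvPolynomial.X (Coord.v j))) S hS
      (fun b hb => by rw [← der_v, hv b hb]) j
  | w j =>
    exact vand (fun j => 2 * (g + 1 - (j + 1)) + c.eps) (exp_inj _ _)
      (fun j => E (MvPolynomial.X (Coord.w j))) S hS
      (fun b hb => by rw [← der_w, hw b hb]) j

section Comm

variable {R : Type} [CommRing R] {A B D ua ub ud va vb vd wa wb wd aub aud avb avd awb awd dub dua dvb dva dwb dwa P Q : R}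

lemma rel_aux (h1 : (B ^ 2 - A ^ 2) * aub = A * ub * va - B * vb * ua)
    (h2 : 2 * (B ^ 2 - A ^ 2) * avb = B * (wb * ua - ub * wa - (B ^ 2 - A ^ 2) * ub * ua))
    (h3 : (B ^ 2 - A ^ 2) * awb = B * vb * wa - A * wb * va + (B ^ 2 - A ^ 2) * B * vb * ua) :
    (B ^ 2 - A ^ 2) * (aub * wb + ub * awb + (avb * vb + vb * avb) - 0) = 0 := by
  linear_combination wb * h1 + ub * h3 + vb * h2

lemma sum_aux {n : ℕ} (p q : Fin n → R) (S T : Fin n → Fin n → R) :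
    ∑ k, q k * ∑ i, p i * (S i k - T i k)
      = (∑ i, p i * ∑ k, q k * S i k) - ∑ k, q k * ∑ i, p i * T i k := by
  simp only [Finset.mul_sum, mul_sub, Finset.sum_sub_distrib]
  congr 1
  rw [Finset.sum_comm]
  exact Finset.sum_congr rfl fun _ _ => Finset.sum_congr rfl fun _ _ => by ring

variable [IsDomain R] [CharZero R]

lemma comm_u_aux (hba : B ^ 2 - A ^ 2 ≠ 0) (hbd : B ^ 2 - D ^ 2 ≠ 0) (hda : D ^ 2 - A ^ 2 ≠ 0)
    (h1 : (B ^ 2 - A ^ 2) * aub = A * ub * va - B * vb * ua)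
    (h2 : (D ^ 2 - A ^ 2) * aud = A * ud * va - D * vd * ua)
    (h3 : 2 * (B ^ 2 - A ^ 2) * avb = B * (wb * ua - ub * wa - (B ^ 2 - A ^ 2) * ub * ua))
    (h4 : 2 * (D ^ 2 - A ^ 2) * avd = D * (wd * ua - ud * wa - (D ^ 2 - A ^ 2) * ud * ua))
    (h5 : (B ^ 2 - D ^ 2) * dub = D * ub * vd - B * vb * ud)
    (h6 : (A ^ 2 - D ^ 2) * dua = D * ua * vd - A * va * ud)
    (h7 : 2 * (B ^ 2 - D ^ 2) * dvb = B * (wb * ud - ub * wd - (B ^ 2 - D ^ 2) * ub * ud))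
    (h8 : 2 * (A ^ 2 - D ^ 2) * dva = A * (wa * ud - ua * wd - (A ^ 2 - D ^ 2) * ua * ud))
    (hP : (B ^ 2 - D ^ 2) * P = D * (aub * vd + ub * avd) - B * (avb * ud + vb * aud))
    (hQ : (B ^ 2 - A ^ 2) * Q = A * (dub * va + ub * dva) - B * (dvb * ua + vb * dua)) :
    P - Q = 0 := by
  have hK : 2 * (B ^ 2 - A ^ 2) * (B ^ 2 - D ^ 2) * (D ^ 2 - A ^ 2) ≠ 0 := by
    simp [hba, hbd, hda]
  refine (mul_eq_zero.1 ?_).resolve_left hK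
  linear_combination 2 * (B ^ 2 - A ^ 2) * (D ^ 2 - A ^ 2) * hP
    - 2 * (B ^ 2 - D ^ 2) * (D ^ 2 - A ^ 2) * hQ
    + 2 * (D ^ 2 - A ^ 2) * D * vd * h1 + (B ^ 2 - A ^ 2) * D * ub * h4
    - (D ^ 2 - A ^ 2) * B * ud * h3 - 2 * (B ^ 2 - A ^ 2) * B * vb * h2
    - 2 * (D ^ 2 - A ^ 2) * A * va * h5 + (B ^ 2 - D ^ 2) * A * ub * h8
    + (D ^ 2 - A ^ 2) * B * ua * h7 - 2 * (B ^ 2 - D ^ 2) * B * vb * h6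

lemma comm_v_aux (hba : B ^ 2 - A ^ 2 ≠ 0) (hbd : B ^ 2 - D ^ 2 ≠ 0) (hda : D ^ 2 - A ^ 2 ≠ 0)
    (h1 : (B ^ 2 - A ^ 2) * aub = A * ub * va - B * vb * ua)
    (h2 : (D ^ 2 - A ^ 2) * aud = A * ud * va - D * vd * ua)
    (h3 : (B ^ 2 - A ^ 2) * awb = B * vb * wa - A * wb * va + (B ^ 2 - A ^ 2) * B * vb * ua)
    (h4 : (D ^ 2 - A ^ 2) * awd = D * vd * wa - A * wd * va + (D ^ 2 - A ^ 2) * D * vd * ua)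
    (h5 : (B ^ 2 - D ^ 2) * dub = D * ub * vd - B * vb * ud)
    (h6 : (A ^ 2 - D ^ 2) * dua = D * ua * vd - A * va * ud)
    (h7 : (B ^ 2 - D ^ 2) * dwb = B * vb * wd - D * wb * vd + (B ^ 2 - D ^ 2) * B * vb * ud)
    (h8 : (A ^ 2 - D ^ 2) * dwa = A * va * wd - D * wa * vd + (A ^ 2 - D ^ 2) * A * va * ud)
    (hP : 2 * (B ^ 2 - D ^ 2) * P = B * (awb * ud + wb * aud - (aub * wd + ub * awd)
      - (B ^ 2 - D ^ 2) * (aub * ud + ub * aud)))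
    (hQ : 2 * (B ^ 2 - A ^ 2) * Q = B * (dwb * ua + wb * dua - (dub * wa + ub * dwa)
      - (B ^ 2 - A ^ 2) * (dub * ua + ub * dua))) :
    P - Q = 0 := by
  have hK : 2 * (B ^ 2 - A ^ 2) * (B ^ 2 - D ^ 2) * (D ^ 2 - A ^ 2) ≠ 0 := by
    simp [hba, hbd, hda]
  refine (mul_eq_zero.1 ?_).resolve_left hK
  linear_combination (B ^ 2 - A ^ 2) * (D ^ 2 - A ^ 2) * hP
    - (B ^ 2 - D ^ 2) * (D ^ 2 - A ^ 2) * hQ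
    + (D ^ 2 - A ^ 2) * B * ud * h3 + (B ^ 2 - A ^ 2) * B * wb * h2
    - (D ^ 2 - A ^ 2) * B * wd * h1 - (B ^ 2 - A ^ 2) * B * ub * h4
    - (D ^ 2 - A ^ 2) * B * (B ^ 2 - D ^ 2) * ud * h1
    - (B ^ 2 - A ^ 2) * B * (B ^ 2 - D ^ 2) * ub * h2
    - (D ^ 2 - A ^ 2) * B * ua * h7 + (B ^ 2 - D ^ 2) * B * wb * h6
    + (D ^ 2 - A ^ 2) * B * wa * h5 - (B ^ 2 - D ^ 2) * B * ub * h8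
    + (D ^ 2 - A ^ 2) * B * (B ^ 2 - A ^ 2) * ua * h5
    - (B ^ 2 - D ^ 2) * B * (B ^ 2 - A ^ 2) * ub * h6

lemma comm_w_aux (hba : B ^ 2 - A ^ 2 ≠ 0) (hbd : B ^ 2 - D ^ 2 ≠ 0) (hda : D ^ 2 - A ^ 2 ≠ 0)
    (h1 : 2 * (B ^ 2 - A ^ 2) * avb = B * (wb * ua - ub * wa - (B ^ 2 - A ^ 2) * ub * ua))
    (h2 : 2 * (D ^ 2 - A ^ 2) * avd = D * (wd * ua - ud * wa - (D ^ 2 - A ^ 2) * ud * ua))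
    (h3 : (B ^ 2 - A ^ 2) * awb = B * vb * wa - A * wb * va + (B ^ 2 - A ^ 2) * B * vb * ua)
    (h4 : (D ^ 2 - A ^ 2) * awd = D * vd * wa - A * wd * va + (D ^ 2 - A ^ 2) * D * vd * ua)
    (h5 : 2 * (B ^ 2 - D ^ 2) * dvb = B * (wb * ud - ub * wd - (B ^ 2 - D ^ 2) * ub * ud))
    (h6 : 2 * (A ^ 2 - D ^ 2) * dva = A * (wa * ud - ua * wd - (A ^ 2 - D ^ 2) * ua * ud))
    (h7 : (B ^ 2 - D ^ 2) * dwb = B * vb * wd - D * wb * vd + (B ^ 2 - D ^ 2) * B * vb * ud)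
    (h8 : (A ^ 2 - D ^ 2) * dwa = A * va * wd - D * wa * vd + (A ^ 2 - D ^ 2) * A * va * ud)
    (h9 : (D ^ 2 - A ^ 2) * aud = A * ud * va - D * vd * ua)
    (h0 : (A ^ 2 - D ^ 2) * dua = D * ua * vd - A * va * ud)
    (hP : (B ^ 2 - D ^ 2) * P = B * (avb * wd + vb * awd) - D * (awb * vd + wb * avd)
      + (B ^ 2 - D ^ 2) * B * (avb * ud + vb * aud))
    (hQ : (B ^ 2 - A ^ 2) * Q = B * (dvb * wa + vb * dwa) - A * (dwb * va + wb * dva)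
      + (B ^ 2 - A ^ 2) * B * (dvb * ua + vb * dua)) :
    P - Q = 0 := by
  have hK : 2 * (B ^ 2 - A ^ 2) * (B ^ 2 - D ^ 2) * (D ^ 2 - A ^ 2) ≠ 0 := by
    simp [hba, hbd, hda]
  refine (mul_eq_zero.1 ?_).resolve_left hK
  linear_combination 2 * (B ^ 2 - A ^ 2) * (D ^ 2 - A ^ 2) * hP
    - 2 * (B ^ 2 - D ^ 2) * (D ^ 2 - A ^ 2) * hQ
    + (D ^ 2 - A ^ 2) * B * wd * h1 + 2 * (B ^ 2 - A ^ 2) * B * vb * h4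
    - 2 * (D ^ 2 - A ^ 2) * D * vd * h3 - (B ^ 2 - A ^ 2) * D * wb * h2
    + (D ^ 2 - A ^ 2) * (B ^ 2 - D ^ 2) * B * ud * h1
    + 2 * (B ^ 2 - A ^ 2) * (B ^ 2 - D ^ 2) * B * vb * h9
    - (D ^ 2 - A ^ 2) * B * wa * h5 + 2 * (B ^ 2 - D ^ 2) * B * vb * h8
    + 2 * (D ^ 2 - A ^ 2) * A * va * h7 - (B ^ 2 - D ^ 2) * A * wb * h6
    - (D ^ 2 - A ^ 2) * (B ^ 2 - A ^ 2) * B * ua * h5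
    + 2 * (B ^ 2 - D ^ 2) * (B ^ 2 - A ^ 2) * B * vb * h0

end Comm

lemma der_mul (E : Derivation ℂ (PhaseRing c g) (PhaseRing c g)) (x y : PhaseRing c g) :
    E (x * y) = E x * y + x * E y := by
  rw [E.leibniz, smul_eq_mul, smul_eq_mul]; ring

lemma der_sq_C (E : Derivation ℂ (PhaseRing c g) (PhaseRing c g)) (b : ℂ) :
    E (MvPolynomial.C b ^ 2) = 0 := by
  rw [← MvPolynomial.C_pow, der_C]

lemma der_two (E : Derivation ℂ (PhaseRing c g) (PhaseRing c g)) : E 2 = 0 := by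
  exact_mod_cast E.map_natCast 2

lemma vfAt_comm_u {a d b : ℂ} (hba : b ∉ bad a) (hbd : b ∉ bad d) (hda : d ∉ bad a) :
    ⁅vfAt c g a, vfAt c g d⁆ (valAt b (uPoly c g)) = 0 := by
  rw [Derivation.commutator_apply]
  have hP := congrArg (vfAt c g a) (evol_u (c := c) (g := g) d b)
  have hQ := congrArg (vfAt c g d) (evol_u (c := c) (g := g) a b)
  simp only [der_mul, map_sub, der_C, der_sq_C] at hP hQ
  refine comm_u_aux (ne_of_not_bad hba) (ne_of_not_bad hbd) (ne_of_not_bad hda)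
    (evol_u a b) (evol_u a d) (evol_v a b) (evol_v a d) (evol_u d b) (evol_u d a) (evol_v d b)
    (evol_v d a) ?_ ?_
  · linear_combination hP
  · linear_combination hQ

lemma vfAt_comm_v {a d b : ℂ} (hba : b ∉ bad a) (hbd : b ∉ bad d) (hda : d ∉ bad a) :
    ⁅vfAt c g a, vfAt c g d⁆ (valAt b (vPoly c g)) = 0 := by
  rw [Derivation.commutator_apply]
  have hP := congrArg (vfAt c g a) (evol_v (c := c) (g := g) d b)
  have hQ := congrArg (vfAt c g d) (evol_v (c := c) (g := g) a b)
  simp only [der_mul, map_sub, der_C, der_sq_C, der_two] at hP hQ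
  refine comm_v_aux (ne_of_not_bad hba) (ne_of_not_bad hbd) (ne_of_not_bad hda)
    (evol_u a b) (evol_u a d) (evol_w a b) (evol_w a d) (evol_u d b) (evol_u d a) (evol_w d b)
    (evol_w d a) ?_ ?_
  · linear_combination hP
  · linear_combination hQ

lemma vfAt_comm_w {a d b : ℂ} (hba : b ∉ bad a) (hbd : b ∉ bad d) (hda : d ∉ bad a) :
    ⁅vfAt c g a, vfAt c g d⁆ (valAt b (wPoly c g)) = 0 := by
  rw [Derivation.commutator_apply]
  have hP := congrArg (vfAt c g a) (evol_w (c := c) (g := g) d b)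
  have hQ := congrArg (vfAt c g d) (evol_w (c := c) (g := g) a b)
  simp only [der_mul, map_sub, map_add, der_C, der_sq_C] at hP hQ
  refine comm_w_aux (ne_of_not_bad hba) (ne_of_not_bad hbd) (ne_of_not_bad hda)
    (evol_v a b) (evol_v a d) (evol_w a b) (evol_w a d) (evol_v d b) (evol_v d a) (evol_w d b)
    (evol_w d a) (evol_u a d) (evol_u d a) ?_ ?_
  · linear_combination hP
  · linear_combination hQ

lemma vfAt_vfAt (a d : ℂ) (y : PhaseRing c g) : vfAt c g a (vfAt c g d y) =
    ∑ i : Fin g, MvPolynomial.C a ^ (2 * (g - (i + 1)) + c.eps) *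
      ∑ k : Fin g, MvPolynomial.C d ^ (2 * (g - (k + 1)) + c.eps) *
        vectorField c g i (vectorField c g k y) := by
  rw [vfAt_apply]
  refine Finset.sum_congr rfl fun i _ => ?_
  rw [vfAt_apply, map_sum, smul_eq, MvPolynomial.C_pow]
  congr 1
  refine Finset.sum_congr rfl fun k _ => ?_
  rw [Derivation.map_smul, smul_eq, MvPolynomial.C_pow]

/-- The vector fields commute. -/
theorem vectorField_comm (i k : Fin g) (y : PhaseRing c g) :
    vectorField c g i (vectorField c g k y) = vectorField c g k (vectorField c g i y) := by
  have key : ∀ y : Coord c g, ⁅vectorField c g i, vectorField c g k⁆ (MvPolynomial.X y) = 0 := by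
    intro y
    refine vand (fun i : Fin g => 2 * (g - (i + 1)) + c.eps) (exp_inj _ _)
      (fun i => ⁅vectorField c g i, vectorField c g k⁆ (MvPolynomial.X y)) ∅ Set.finite_empty
      (fun a _ => ?_) i
    refine vand (fun k : Fin g => 2 * (g - (k + 1)) + c.eps) (exp_inj _ _)
      (fun k => ∑ i : Fin g, MvPolynomial.C a ^ (2 * (g - (i + 1)) + c.eps) *
        ⁅vectorField c g i, vectorField c g k⁆ (MvPolynomial.X y)) (bad a) (bad_finite a)
      (fun d hd => ?_) k
    have h := der_eq_zero ⁅vfAt c g a, vfAt c g d⁆ (bad a ∪ bad d)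
      ((bad_finite a).union (bad_finite d))
      (fun b hb => vfAt_comm_u (fun h => hb (Or.inl h)) (fun h => hb (Or.inr h)) hd)
      (fun b hb => vfAt_comm_v (fun h => hb (Or.inl h)) (fun h => hb (Or.inr h)) hd)
      (fun b hb => vfAt_comm_w (fun h => hb (Or.inl h)) (fun h => hb (Or.inr h)) hd) y
    rw [← h]
    rw [Derivation.commutator_apply, vfAt_vfAt, vfAt_vfAt]
    exact sum_aux _ _ (fun i k => vectorField c g i (vectorField c g k (MvPolynomial.X y)))
      (fun i k => vectorField c g k (vectorField c g i (MvPolynomial.X y)))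
  have h0 : ⁅vectorField c g i, vectorField c g k⁆ = 0 :=
    MvPolynomial.derivation_ext fun y => key y
  have := congrArg (fun E => E y) h0
  simpa [Derivation.commutator_apply, sub_eq_zero] using this

lemma vfAt_rel (f : ℂ[X]) {a b : ℂ} (hba : b ∉ bad a) :
    vfAt c g a (valAt b (uPoly c g * wPoly c g + vPoly c g ^ 2 - f.map MvPolynomial.C)) = 0 := by
  have hf : valAt b (f.map MvPolynomial.C) = (MvPolynomial.C (f.eval b) : PhaseRing c g) := by
    rw [valAt, eval_map_apply]
  have : valAt b (uPoly c g * wPoly c g + vPoly c g ^ 2 - f.map MvPolynomial.C)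
      = valAt b (uPoly c g) * valAt b (wPoly c g) + valAt b (vPoly c g) * valAt b (vPoly c g)
        - MvPolynomial.C (f.eval b) := by
    rw [← hf]
    simp only [valAt, eval_sub, eval_add, eval_mul, eval_pow]
    ring
  rw [this]
  simp only [map_sub, map_add, der_mul, der_C]
  have h := rel_aux (evol_u (c := c) (g := g) a b) (evol_v a b) (evol_w a b)
  have h' := (mul_eq_zero.1 h).resolve_left (ne_of_not_bad hba)
  rw [sub_zero] at h' ⊢
  exact h'

lemma vand_D (E : Fin g → PhaseRing c g) (S : Set ℂ) (hS : S.Finite)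
    (h : ∀ a ∉ S, ∑ i : Fin g, a ^ (2 * (g - (i + 1)) + c.eps) • E i = 0) (i : Fin g) :
    E i = 0 :=
  vand (fun i : Fin g => 2 * (g - (i + 1)) + c.eps) (exp_inj _ _) E S hS (fun a ha => by
    rw [← h a ha]
    exact Finset.sum_congr rfl fun i _ => by rw [smul_eq, MvPolynomial.C_pow]) i

lemma vfAt_coeff (p : (PhaseRing c g)[X]) (a : ℂ)
    (h0 : ∀ b ∉ bad a, vfAt c g a (valAt b p) = 0) (n : ℕ) : vfAt c g a (p.coeff n) = 0 := by
  rcases lt_or_ge p.natDegree n with h | h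
  · rw [coeff_eq_zero_of_natDegree_lt h, map_zero]
  · refine vand (fun j : Fin (p.natDegree + 1) => (j : ℕ)) Fin.val_injective
      (fun j => vfAt c g a (p.coeff j)) (bad a) (bad_finite a) (fun b hb => ?_)
      ⟨n, Nat.lt_succ_of_le h⟩
    rw [← h0 b hb, valAt, eval_eq_sum_range, map_sum, Finset.sum_range]
    simp only [der_C_pow_mul]

/-- The vector fields kill the coefficients of `u(x) w(x) + v(x)² - f(x)`. -/
theorem vectorField_rel (f : ℂ[X]) (i : Fin g) (n : ℕ) : vectorField c g i
    ((uPoly c g * wPoly c g + vPoly c g ^ 2 - f.map MvPolynomial.C).coeff n) = 0 := by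
  refine vand_D (fun i => vectorField c g i _) ∅ Set.finite_empty (fun a _ => ?_) i
  rw [← vfAt_apply]
  exact vfAt_coeff _ a (fun b hb => vfAt_rel f hb) n

theorem vectorField_mem (f : ℂ[X]) (i : Fin g) {y : PhaseRing c g} (hy : y ∈ levelIdeal c g f) :
    vectorField c g i y ∈ levelIdeal c g f := by
  induction hy using Submodule.span_induction with
  | mem y hy =>
    obtain ⟨n, rfl⟩ := hy
    rw [vectorField_rel]
    exact zero_mem _
  | zero => rw [map_zero]; exact zero_mem _
  | add y z _ _ hy hz => rw [map_add]; exact add_mem hy hz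
  | smul r y hy h =>
    rw [smul_eq_mul, der_mul]
    exact add_mem (Ideal.mul_mem_left _ _ hy) (Ideal.mul_mem_left _ _ h)

end Proofs

/-! ### The complexes -/

section Complex

variable {R : Type} [CommRing R] {g}

/-- `dt_{φ(0)} ∧ ⋯ ∧ dt_{φ(k-1)}` in the `k`-th exterior power of the free `R`-module with basis
`dt_0, …, dt_{g-1}`. -/
def dtForm (R : Type) [CommRing R] {g k : ℕ} (φ : Fin k → Fin g) : ⋀[R]^k (Fin g → R) :=
  exteriorPower.ιMulti R k fun s => Pi.basisFun R (Fin g) (φ s)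

/-- The coefficient `a_I` of `ω = ∑_I a_I dt_I`, where `I` runs over the `k`-element subsets and
`dt_I = dt_{i_1} ∧ ⋯ ∧ dt_{i_k}` for `i_1 < ⋯ < i_k` the elements of `I`. -/
def formCoeff {k : ℕ} (ω : ⋀[R]^k (Fin g → R)) (I : Set.powersetCard (Fin g) k) : R :=
  ((Pi.basisFun R (Fin g)).exteriorPower k).repr ω I

lemma dtForm_eq_basis {k : ℕ} (I : Set.powersetCard (Fin g) k) :
    dtForm R (Set.powersetCard.ofFinEmbEquiv.symm I)
      = (Pi.basisFun R (Fin g)).exteriorPower k I := by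
  rw [exteriorPower.basis_apply]
  rfl

lemma eq_sum_form {k : ℕ} (ω : ⋀[R]^k (Fin g → R)) :
    ω = ∑ I, formCoeff ω I • dtForm R (Set.powersetCard.ofFinEmbEquiv.symm I) := by
  simp only [dtForm_eq_basis, formCoeff]
  exact (((Pi.basisFun R (Fin g)).exteriorPower k).sum_repr ω).symm

lemma dtForm_cons {k : ℕ} (i : Fin g) (φ : Fin k → Fin g) : dtForm R (Fin.cons i φ) =
    (exteriorPower.ιMulti R (k + 1)).curryLeft (Pi.basisFun R (Fin g) i)
      (fun s => Pi.basisFun R (Fin g) (φ s)) := by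
  rw [dtForm, AlternatingMap.curryLeft_apply_apply]
  congr 1
  funext s
  induction s using Fin.cases <;> rfl

lemma dtForm_swap {k : ℕ} (i j : Fin g) (φ : Fin k → Fin g) :
    dtForm R (Fin.cons j (Fin.cons i φ)) = -dtForm R (Fin.cons i (Fin.cons j φ)) := by
  have h := AlternatingMap.map_swap (exteriorPower.ιMulti R (k + 2))
    (fun s => Pi.basisFun R (Fin g) ((Fin.cons i (Fin.cons j φ) : Fin (k + 2) → Fin g) s))
    (i := 0) (j := 1) (by simp)
  refine Eq.trans ?_ h
  rw [dtForm]
  congr 1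
  funext s
  refine congrArg (Pi.basisFun R (Fin g)) ?_
  induction s using Fin.cases with
  | zero => rw [Equiv.swap_apply_left]; rfl
  | succ s =>
    induction s using Fin.cases with
    | zero => rw [show (Fin.succ 0 : Fin (k + 2)) = 1 from rfl, Equiv.swap_apply_right]; rfl
    | succ s =>
      rw [Equiv.swap_apply_of_ne_of_ne (by simp) (by simp [Fin.ext_iff])]
      rfl

lemma formCoeff_add {k : ℕ} (ω η : ⋀[R]^k (Fin g → R)) (I : Set.powersetCard (Fin g) k) :
    formCoeff (ω + η) I = formCoeff ω I + formCoeff η I := by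
  simp only [formCoeff, map_add, Finsupp.add_apply]

lemma formCoeff_smul_form {k : ℕ} (a : R) (I J : Set.powersetCard (Fin g) k) :
    formCoeff (a • dtForm R (Set.powersetCard.ofFinEmbEquiv.symm I)) J = if I = J then a else 0 := by
  rw [formCoeff, dtForm_eq_basis, map_smul, Module.Basis.repr_self, Finsupp.smul_apply,
    Finsupp.single_apply, smul_eq_mul, mul_ite, mul_one, mul_zero]

variable [Algebra ℂ R]

lemma formCoeff_smul {k : ℕ} (r : ℂ) (ω : ⋀[R]^k (Fin g → R)) (I : Set.powersetCard (Fin g) k) :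
    formCoeff (r • ω) I = r • formCoeff ω I := by
  rw [formCoeff, formCoeff, ← algebraMap_smul R r ω, map_smul, Finsupp.smul_apply, algebraMap_smul]

/-- The differential `d = ∑_i dt_i ∧ D_i`, that is,
`d (∑_I a_I dt_I) = ∑_i ∑_I D_i(a_I) dt_i ∧ dt_I`. -/
def differential (D : Fin g → Derivation ℂ R R) (k : ℕ) :
    ⋀[R]^k (Fin g → R) →ₗ[ℂ] ⋀[R]^(k + 1) (Fin g → R) where
  toFun ω := ∑ i, ∑ I : Set.powersetCard (Fin g) k,
    D i (formCoeff ω I) • dtForm R (Fin.cons i (Set.powersetCard.ofFinEmbEquiv.symm I))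
  map_add' ω η := by
    simp only [formCoeff_add, map_add, add_smul, Finset.sum_add_distrib]
  map_smul' r ω := by
    simp only [formCoeff_smul, RingHom.id_apply, Finset.smul_sum, Derivation.map_smul, smul_assoc]

lemma differential_apply (D : Fin g → Derivation ℂ R R) (k : ℕ) (ω : ⋀[R]^k (Fin g → R)) :
    differential D k ω = ∑ i, ∑ I : Set.powersetCard (Fin g) k,
      D i (formCoeff ω I) • dtForm R (Fin.cons i (Set.powersetCard.ofFinEmbEquiv.symm I)) :=
  rfl

lemma differential_basis (D : Fin g → Derivation ℂ R R) {k : ℕ} (a : R)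
    (I : Set.powersetCard (Fin g) k) :
    differential D k (a • dtForm R (Set.powersetCard.ofFinEmbEquiv.symm I)) =
      ∑ i, D i a • dtForm R (Fin.cons i (Set.powersetCard.ofFinEmbEquiv.symm I)) := by
  rw [differential_apply]
  refine Finset.sum_congr rfl fun i _ => ?_
  rw [Finset.sum_eq_single_of_mem I (Finset.mem_univ _)]
  · rw [formCoeff_smul_form, if_pos rfl]
  · intro J _ hJ
    rw [formCoeff_smul_form, if_neg hJ.symm, map_zero, zero_smul]

lemma differential_form (D : Fin g → Derivation ℂ R R) {k : ℕ} (a : R) (φ : Fin k → Fin g) :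
    differential D k (a • dtForm R φ) = ∑ i, D i a • dtForm R (Fin.cons i φ) := by
  by_cases hφ : Function.Injective φ
  · have hs : StrictMono (φ ∘ Tuple.sort φ) :=
      (Tuple.monotone_sort φ).strictMono_of_injective (hφ.comp (Tuple.sort φ).injective)
    obtain ⟨I, hI⟩ : ∃ I, (Set.powersetCard.ofFinEmbEquiv.symm I : Fin k → Fin g)
        = φ ∘ Tuple.sort φ :=
      ⟨Set.powersetCard.ofFinEmbEquiv (OrderEmbedding.ofStrictMono _ hs), by
        rw [Equiv.symm_apply_apply]; rfl⟩
    have h0 : dtForm R (φ ∘ Tuple.sort φ)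
        = Equiv.Perm.sign (Tuple.sort φ) • dtForm R φ :=
      AlternatingMap.map_perm (exteriorPower.ιMulti R k)
        (fun s => Pi.basisFun R (Fin g) (φ s)) (Tuple.sort φ)
    have h1 : ∀ i, dtForm R (Fin.cons i (φ ∘ Tuple.sort φ))
        = Equiv.Perm.sign (Tuple.sort φ) • dtForm R (Fin.cons i φ) := by
      intro i
      rw [dtForm_cons, dtForm_cons]
      exact AlternatingMap.map_perm
        ((exteriorPower.ιMulti R (k + 1)).curryLeft (Pi.basisFun R (Fin g) i))
        (fun s => Pi.basisFun R (Fin g) (φ s)) (Tuple.sort φ)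
    have h2 := differential_basis D a I
    rw [hI, h0] at h2
    simp only [h1] at h2
    rcases Int.units_eq_one_or (Equiv.Perm.sign (Tuple.sort φ)) with h | h
    · simpa [h] using h2
    · simpa [h] using h2
  · have h0 : dtForm R φ = 0 := by
      refine AlternatingMap.map_eq_zero_of_not_injective _ _ fun h => hφ fun s t hst => h ?_
      exact congrArg (Pi.basisFun R (Fin g)) hst
    have h1 : ∀ i, dtForm R (Fin.cons i φ) = 0 := by
      intro i
      rw [dtForm_cons]
      refine AlternatingMap.map_eq_zero_of_not_injective _ _ fun h => hφ fun s t hst => h ?_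
      exact congrArg (Pi.basisFun R (Fin g)) hst
    simp [h0, h1]

theorem differential_comp (D : Fin g → Derivation ℂ R R)
    (hD : ∀ i j a, D i (D j a) = D j (D i a)) (k : ℕ) :
    (differential D (k + 1)).comp (differential D k) = 0 := by
  ext1 ω
  rw [LinearMap.comp_apply, LinearMap.zero_apply, eq_sum_form ω, map_sum, map_sum]
  refine Finset.sum_eq_zero fun I _ => ?_
  rw [differential_form, map_sum]
  simp only [differential_form]
  generalize formCoeff ω I = a
  generalize (Set.powersetCard.ofFinEmbEquiv.symm I : Fin k → Fin g) = φ
  have h : (∑ i, ∑ j, D j (D i a) • dtForm R (Fin.cons j (Fin.cons i φ)))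
      = -∑ i, ∑ j, D j (D i a) • dtForm R (Fin.cons j (Fin.cons i φ)) := by
    conv_lhs => rw [Finset.sum_comm]
    simp only [← Finset.sum_neg_distrib]
    refine Finset.sum_congr rfl fun i _ => Finset.sum_congr rfl fun j _ => ?_
    rw [hD, dtForm_swap, smul_neg]
  generalize (∑ i, ∑ j, D j (D i a) • dtForm R (Fin.cons j (Fin.cons i φ))) = S at h
  have h2 : (2 : ℂ) • S = 0 := by rw [two_smul]; nth_rewrite 1 [h]; exact neg_add_cancel S
  exact (smul_eq_zero.1 h2).resolve_left two_ne_zero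

end Complex

/-- The vector field `D_{i+1}` on the level set over `f`. -/
def levelVectorField (f : ℂ[X]) (i : Fin g) : Derivation ℂ (LevelRing c g f) (LevelRing c g f) :=
  Derivation.liftOfSurjective (f := Ideal.Quotient.mkₐ ℂ (levelIdeal c g f))
    (Ideal.Quotient.mkₐ_surjective _ _) (d := vectorField c g i) fun _ hy =>
      Ideal.Quotient.eq_zero_iff_mem.2 (vectorField_mem f i (Ideal.Quotient.eq_zero_iff_mem.1 hy))

lemma levelVectorField_mk (f : ℂ[X]) (i : Fin g) (y : PhaseRing c g) :
    levelVectorField c g f i (Ideal.Quotient.mkₐ ℂ (levelIdeal c g f) y)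
      = Ideal.Quotient.mkₐ ℂ (levelIdeal c g f) (vectorField c g i y) :=
  Derivation.liftOfSurjective_apply (Ideal.Quotient.mkₐ_surjective ℂ (levelIdeal c g f))
    (fun _ hy => Ideal.Quotient.eq_zero_iff_mem.2
      (vectorField_mem f i (Ideal.Quotient.eq_zero_iff_mem.1 hy))) y

lemma levelVectorField_comm (f : ℂ[X]) (i j : Fin g) (a : LevelRing c g f) :
    levelVectorField c g f i (levelVectorField c g f j a)
      = levelVectorField c g f j (levelVectorField c g f i a) := by
  obtain ⟨y, rfl⟩ := Ideal.Quotient.mkₐ_surjective ℂ (levelIdeal c g f) a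
  rw [levelVectorField_mk, levelVectorField_mk, levelVectorField_mk, levelVectorField_mk,
    vectorField_comm i j]

open CategoryTheory in
/-- The complex `0 → C_f^0 → C_f^1 → ⋯ → C_f^g → 0` of the level set over `f`: `C_f^k` is the
`k`-th exterior power of the free `𝒜_f`-module with basis `dt_1, …, dt_g` (it is zero for `k > g`),
and the differential is `d = ∑ dt_i ∧ D_i`. -/
def prymComplex (f : ℂ[X]) : CochainComplex (ModuleCat.{0} ℂ) ℕ :=
  CochainComplex.of
    (fun k => ModuleCat.of ℂ (⋀[LevelRing c g f]^k (Fin g → LevelRing c g f)))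
    (fun k => ModuleCat.ofHom (differential (levelVectorField c g f) k))
    (fun k => by
      rw [← ModuleCat.ofHom_comp, differential_comp _ (levelVectorField_comm c g f) k]
      rfl)

/-! ### The grading at `f = x^{4g+2}`, `f = x^{4g+4}`, and the `q`-Euler characteristic -/

/-- `x^{4g+2}` in case (I), `x^{4g+4}` in case (II). -/
def f₀ : PrymType → ℕ → ℂ[X]
  | .I, g => X ^ (4 * g + 2)
  | .II, g => X ^ (4 * g + 4)

/-- The part of degree `n` of the graded ring `𝒜₀ = 𝒜_{f₀}`. -/
def ringPart (n : ℕ) : Submodule ℂ (LevelRing c g (f₀ c g)) :=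
  (MvPolynomial.weightedHomogeneousSubmodule ℂ (Coord.deg (c := c) (g := g)) n).map
    (Ideal.Quotient.mkₐ ℂ (levelIdeal c g (f₀ c g))).toLinearMap

/-- The part of degree `m` of `C_0^k`, where `dt_i` has degree `-i`: it is spanned by the
`a dt_I`, `a ∈ 𝒜₀` of degree `n`, with `n - ∑_{i ∈ I} i = m`. (`I` is a set of `k` indices, which
start from `0` here.) -/
def formPart (k : ℕ) (m : ℤ) : Submodule ℂ ((prymComplex c g (f₀ c g)).X k) :=
  Submodule.span ℂ {ω : ⋀[LevelRing c g (f₀ c g)]^k (Fin g → LevelRing c g (f₀ c g)) |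
    ∃ (n : ℕ) (a : LevelRing c g (f₀ c g)) (I : Set.powersetCard (Fin g) k),
      a ∈ ringPart c g n ∧ (n : ℤ) - ∑ i ∈ (I : Finset (Fin g)), ((i : ℤ) + 1) = m ∧
      ω = a • dtForm _ (Set.powersetCard.ofFinEmbEquiv.symm I)}

/-- The parts of a graded space are finite dimensional, and zero in all low degrees. -/
def IsFiniteType {V : Type} [AddCommGroup V] [Module ℂ V] (gr : ℤ → Submodule ℂ V) : Prop :=
  (∀ m, FiniteDimensional ℂ (gr m)) ∧ ∃ N : ℤ, ∀ m < N, gr m = ⊥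

open Classical in
/-- The character `ch = ∑_m q^m dim V^{(m)}` of a graded space of finite type, as a formal Laurent
series in `q` (and `0` if the degrees are not bounded below). -/
def ch {V : Type} [AddCommGroup V] [Module ℂ V] (gr : ℤ → Submodule ℂ V) : LaurentSeries ℚ :=
  if h : BddBelow (Function.support fun m => (Module.finrank ℂ (gr m) : ℚ)) then
    HahnSeries.ofSuppBddBelow _ h
  else 0

/-- The `q`-Euler characteristic `∑_{k=0}^n (-1)^k ch(C^k)` of a complex `C` in degrees `0, …, n`
with a grading on each of its terms. -/
def qEulerChar (C : CochainComplex (ModuleCat.{0} ℂ) ℕ) (n : ℕ)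
    (gr : ∀ k, ℤ → Submodule ℂ (C.X k)) : LaurentSeries ℚ :=
  ∑ k ∈ Finset.range (n + 1), (-1) ^ k * ch (gr k)

/-- `[k]_q! = (1 - q^k) (1 - q^{k-1}) ⋯ (1 - q)`. -/
def qFactorial {K : Type} [Field K] (q : K) (k : ℕ) : K :=
  ∏ i ∈ Finset.range k, (1 - q ^ (i + 1))

/-- `(-1)^g q^{-g(g+1)/2} [2g+1]_q! / ([g]_q! [g+1]_q!)`. -/
def valueI {K : Type} [Field K] (q : K) (g : ℕ) : K :=
  (-1) ^ g * (q ^ (g * (g + 1) / 2))⁻¹ *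
    (qFactorial q (2 * g + 1) / (qFactorial q g * qFactorial q (g + 1)))

/-- `(-1)^g q^{-g(g+1)/2} [2g+2]_q! / ([g+1]_q!)²`. -/
def valueII {K : Type} [Field K] (q : K) (g : ℕ) : K :=
  (-1) ^ g * (q ^ (g * (g + 1) / 2))⁻¹ *
    (qFactorial q (2 * g + 2) / qFactorial q (g + 1) ^ 2)

/-- The variable `q` of the field of formal Laurent series. -/
def qVar : LaurentSeries ℚ := HahnSeries.single 1 1

end

end HyperellipticPrym

/-! The differential plays no part in the Euler characteristic: only the Hilbert series `H` of `𝒜₀`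
and the degrees of the basis forms matter. The form `dt_I` has degree minus the sum of the indices
in `I`, so the alternating sum over all subsets expands a product and gives `χ = H · ∏ (1 -
q^{-i})`, `i = 1, …, g` (`qEulerChar_eq`). This product is `(-1)^g q^{-g(g+1)/2} [g]_q!`.

To find `H`, put `y = x²`. The relations become one equation `U W = P` between monic polynomials in
`y` of degrees `g`, `g + 1` and `2g + 1`, where the coefficients of `P` are polynomials in the
coefficients of `V`, a polynomial obtained from `v`. In case (II) there is the further relation
`V(0)² = 0` (`levelIdeal_eq_map`). Thus `𝒜₀` arises by base change from the ring of factorizations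
of the generic monic polynomial of degree `2g + 1`: that polynomial is specialised to `P`, and the
further relation is imposed.

The Hilbert series of factorizations into degrees `a` and `b` comes from adjoining roots. Adjoining
one root to a generic monic polynomial of degree `n + 1` is a graded free extension with basis `1,
t, …, t^n` (`adjoinRootHom_bijective`). A root of the first factor can be adjoined after the
factorization, or it can be adjoined as a root of the whole polynomial, with the cofactor factored
afterwards; the result is the same. Comparing the two and inducting on `a` shows that passing to
factorizations multiplies the Hilbert series by the Gaussian binomial coefficient
(`hilb_factorHom`). The statement is made for the extension of an arbitrary ideal, which both the
induction and the specialisation to `P` need.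

It remains to treat the coefficients of `V`. In case (I) they are `g` free variables of weights `1,
…, g`. In case (II) they are `g + 1` variables of weights `1, …, g + 1`, and killing the square of
the heaviest contributes `1 - q^{2g+2}`. Hence `levelHilb_I` and `levelHilb_II`; the factor `[g]_q!`
from the forms cancels one in the denominator of `H`. For `q → 1`, equal powers of `1 - q` cancel in
the `q`-binomial coefficient. -/

namespace HyperellipticPrym

noncomputable section

open MvPolynomial (IsWeightedHomogeneous weightedHomogeneousSubmodule weightedHomogeneousComponent)

/-! ### Hilbert series of quotients of weighted polynomial rings -/

section Hilbert

variable {σ σ' : Type} (w : σ → ℕ) (w' : σ' → ℕ)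

/-- The image of the part of weight `n` of a polynomial ring in the quotient by an ideal. -/
def quotPart (I : Ideal (MvPolynomial σ ℂ)) (n : ℕ) : Submodule ℂ (MvPolynomial σ ℂ ⧸ I) :=
  (weightedHomogeneousSubmodule ℂ w n).map (Ideal.Quotient.mkₐ ℂ I).toLinearMap

/-- The Hilbert series of the quotient of a weighted polynomial ring by an ideal. -/
def hilb (I : Ideal (MvPolynomial σ ℂ)) : PowerSeries ℚ :=
  PowerSeries.mk fun n => (Module.finrank ℂ (quotPart w I n) : ℚ)

variable {w w'}

lemma finite_part [Finite σ] (hw : ∀ x, w x ≠ 0) (n : ℕ) :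
    Module.Finite ℂ (weightedHomogeneousSubmodule ℂ w n) :=
  Module.Finite.iff_fg.2 (MvPolynomial.weightedHomogeneousSubmodule_fg ℂ w hw n)

lemma finite_quotPart [Finite σ] (hw : ∀ x, w x ≠ 0) (I : Ideal (MvPolynomial σ ℂ)) (n : ℕ) :
    Module.Finite ℂ (quotPart w I n) := by
  have := finite_part hw n
  unfold quotPart
  infer_instance

lemma isWeightedHomogeneous_aeval {φ : MvPolynomial σ ℂ →ₐ[ℂ] MvPolynomial σ' ℂ}
    (hφ : ∀ x, IsWeightedHomogeneous w' (φ (MvPolynomial.X x)) (w x)) {p : MvPolynomial σ ℂ} {n : ℕ}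
    (hp : IsWeightedHomogeneous w p n) : IsWeightedHomogeneous w' (φ p) n := by
  rw [MvPolynomial.as_sum p, map_sum]
  refine MvPolynomial.IsWeightedHomogeneous.sum _ _ _ fun d hd => ?_
  have hd' := hp (MvPolynomial.mem_support_iff.1 hd)
  rw [MvPolynomial.monomial_eq, map_mul, ← MvPolynomial.algebraMap_eq, AlgHom.commutes,
    MvPolynomial.algebraMap_eq, Finsupp.prod, map_prod]
  refine MvPolynomial.IsWeightedHomogeneous.C_mul ?_ _
  have := MvPolynomial.IsWeightedHomogeneous.prod d.support
    (fun x => φ (MvPolynomial.X x ^ d x)) (fun x => d x • w x) (w := w')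
    fun x _ => by rw [map_pow]; exact (hφ x).pow _
  rwa [← hd', Finsupp.weight_apply, Finsupp.sum]

/-- Both images are the same quotient of `V`. Graded pieces of different quotient rings are compared
below by presenting them as images of one space. -/
lemma finrank_range_eq_of_ker_eq {V W₁ W₂ : Type} [AddCommGroup V] [Module ℂ V]
    [AddCommGroup W₁] [Module ℂ W₁] [AddCommGroup W₂] [Module ℂ W₂]
    (f : V →ₗ[ℂ] W₁) (h : V →ₗ[ℂ] W₂) (hk : LinearMap.ker f = LinearMap.ker h) :
    Module.finrank ℂ (LinearMap.range f) = Module.finrank ℂ (LinearMap.range h) :=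
  ((f.quotKerEquivRange.symm.trans (Submodule.quotEquivOfEq _ _ hk)).trans
    h.quotKerEquivRange).finrank_eq

lemma quotPart_eq_range (I : Ideal (MvPolynomial σ ℂ)) (n : ℕ) :
    quotPart w I n = LinearMap.range ((Ideal.Quotient.mkₐ ℂ I).toLinearMap ∘ₗ
      (weightedHomogeneousSubmodule ℂ w n).subtype) := by
  rw [LinearMap.range_comp, Submodule.range_subtype, quotPart]

/-- The Hilbert series does not change along a graded retraction of polynomial rings. -/
theorem hilb_comap (π : MvPolynomial σ ℂ →ₐ[ℂ] MvPolynomial σ' ℂ)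
    (s : MvPolynomial σ' ℂ →ₐ[ℂ] MvPolynomial σ ℂ)
    (hπ : ∀ x, IsWeightedHomogeneous w' (π (MvPolynomial.X x)) (w x))
    (hs : ∀ x, IsWeightedHomogeneous w (s (MvPolynomial.X x)) (w' x))
    (hπs : ∀ x, π (s (MvPolynomial.X x)) = MvPolynomial.X x) (I : Ideal (MvPolynomial σ' ℂ)) :
    hilb w (I.comap π) = hilb w' I := by
  ext n
  simp only [hilb, PowerSeries.coeff_mk, Nat.cast_inj]
  have hid : ∀ y, π (s y) = y := fun y =>
    DFunLike.congr_fun (MvPolynomial.algHom_ext (f := π.comp s) (g := AlgHom.id ℂ _) hπs) y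
  -- Both graded pieces are images of the weight `n` part of the larger ring; the kernels agree by
  -- the definition of the preimage ideal. The section `s` makes `π` surjective in each weight.
  rw [quotPart_eq_range, finrank_range_eq_of_ker_eq _ ((Ideal.Quotient.mkₐ ℂ I).toLinearMap ∘ₗ
    π.toLinearMap ∘ₗ (weightedHomogeneousSubmodule ℂ w n).subtype), LinearMap.range_comp,
    LinearMap.range_comp, Submodule.range_subtype, quotPart]
  · have : (weightedHomogeneousSubmodule ℂ w n).map π.toLinearMap
        = weightedHomogeneousSubmodule ℂ w' n := by
      refine le_antisymm (Submodule.map_le_iff_le_comap.2 fun p hp => ?_) fun p hp => ?_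
      · exact isWeightedHomogeneous_aeval hπ hp
      · exact ⟨s p, isWeightedHomogeneous_aeval hs hp, hid p⟩
    rw [this]
  · ext x
    simp [Ideal.Quotient.eq_zero_iff_mem]

/-- Recognition of the preimage of an ideal under a retraction. -/
lemma eq_comap_of_retraction {A B : Type} [CommRing A] [CommRing B] [Algebra ℂ A] [Algebra ℂ B]
    (π : A →ₐ[ℂ] B) (s : B →ₐ[ℂ] A) {J : Ideal A} {I : Ideal B}
    (hJ : J ≤ I.comap π) (hI : I ≤ J.comap s)
    (h : ((Ideal.Quotient.mkₐ ℂ J).comp s).comp π = Ideal.Quotient.mkₐ ℂ J) :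
    J = I.comap π := by
  refine le_antisymm hJ fun x hx => ?_
  -- Modulo `J` the composite `s ∘ π` is the identity, so `x` is congruent to this element of `J`.
  have h1 : s (π x) ∈ J := hI hx
  have h2 : Ideal.Quotient.mkₐ ℂ J (s (π x)) = Ideal.Quotient.mkₐ ℂ J x := DFunLike.congr_fun h x
  rw [Ideal.Quotient.mkₐ_eq_mk, Ideal.Quotient.eq_zero_iff_mem.2 h1] at h2
  exact Ideal.Quotient.eq_zero_iff_mem.1 h2.symm

/-! ### Graded free extensions and hypersurfaces -/

variable (w) in
/-- The part of weight `n - d`, which is zero if `n < d`. -/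
def shiftPart (n d : ℕ) : Submodule ℂ (MvPolynomial σ ℂ) :=
  if d ≤ n then weightedHomogeneousSubmodule ℂ w (n - d) else ⊥

lemma finite_shiftPart [Finite σ] (hw : ∀ x, w x ≠ 0) (n d : ℕ) :
    Module.Finite ℂ (shiftPart w n d) := by
  rcases le_or_gt d n with h | h
  · rw [shiftPart, if_pos h]
    exact finite_part hw _
  · rw [shiftPart, if_neg (by omega)]
    infer_instance

/-- Since `φ` is graded and `b` homogeneous, taking a component of the product only selects the
monomials of `a` of complementary weight. This replaces arbitrary coefficients by homogeneous ones.
-/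
lemma exists_component_mul {φ : MvPolynomial σ ℂ →ₐ[ℂ] MvPolynomial σ' ℂ}
    (hφ : ∀ x, IsWeightedHomogeneous w' (φ (MvPolynomial.X x)) (w x)) {b : MvPolynomial σ' ℂ}
    {d : ℕ} (hb : IsWeightedHomogeneous w' b d) (n : ℕ) (a : MvPolynomial σ ℂ) :
    ∃ a' ∈ shiftPart w n d, weightedHomogeneousComponent w' n (φ a * b) = φ a' * b := by
  induction a using MvPolynomial.monomial_add_induction_on with
  | C r =>
    have h : IsWeightedHomogeneous w' (φ (MvPolynomial.C r) * b) d := by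
      rw [← MvPolynomial.algebraMap_eq, AlgHom.commutes, MvPolynomial.algebraMap_eq]
      exact hb.C_mul r
    by_cases hn : d = n
    · subst hn
      refine ⟨MvPolynomial.C r, ?_, h.weightedHomogeneousComponent_same⟩
      simpa [shiftPart] using MvPolynomial.isWeightedHomogeneous_C w r
    · exact ⟨0, zero_mem _, by rw [h.weightedHomogeneousComponent_ne _ (Ne.symm hn)]; simp⟩
  | monomial_add e r p _ _ hp =>
    obtain ⟨a', ha', he⟩ := hp
    have hm := MvPolynomial.isWeightedHomogeneous_monomial w e r rfl
    have h := (isWeightedHomogeneous_aeval hφ hm).mul hb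
    by_cases hn : Finsupp.weight w e + d = n
    · refine ⟨MvPolynomial.monomial e r + a', add_mem ?_ ha', ?_⟩
      · rw [shiftPart, if_pos (by omega)]
        rwa [show n - d = Finsupp.weight w e by omega]
      · rw [map_add, map_add, add_mul, add_mul, map_add, he, ← hn,
          h.weightedHomogeneousComponent_same]
    · refine ⟨a', ha', ?_⟩
      rw [map_add, add_mul, map_add, he, h.weightedHomogeneousComponent_ne _ (Ne.symm hn), zero_add]

/-- For a free extension with basis `b`, the extended ideal is the direct sum of the `I b_j`. The
elements with some coordinates in `I` form an ideal containing `φ(I)`, and coordinates are unique.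
-/
lemma sum_mul_mem_map_iff {A B ι : Type} [CommRing A] [CommRing B] [Fintype ι] (φ : A →+* B)
    (b : ι → B) (hbij : Function.Bijective fun a : ι → A => ∑ j, φ (a j) * b j) (I : Ideal A)
    (a : ι → A) : ∑ j, φ (a j) * b j ∈ I.map φ ↔ ∀ j, a j ∈ I := by
  refine ⟨fun h => ?_, fun h => Ideal.sum_mem _ fun j _ =>
    Ideal.mul_mem_right _ _ (Ideal.mem_map_of_mem φ (h j))⟩
  have key : ∀ y ∈ I.map φ, ∃ a' : ι → A, (∀ j, a' j ∈ I) ∧ ∑ j, φ (a' j) * b j = y := by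
    intro y hy
    induction hy using Submodule.span_induction with
    | mem y hy =>
      obtain ⟨r, hr, rfl⟩ := hy
      -- The basis need not contain `1`, so `φ r` is expanded through the coordinates of `1`.
      obtain ⟨c, hc⟩ := hbij.2 1
      refine ⟨fun j => r * c j, fun j => Ideal.mul_mem_right _ _ hr, ?_⟩
      have := congrArg (φ r * ·) hc
      simpa [Finset.mul_sum, mul_assoc] using this
    | zero => exact ⟨0, fun j => zero_mem _, by simp⟩
    | add x y _ _ hx hy =>
      obtain ⟨a₁, h₁, rfl⟩ := hx
      obtain ⟨a₂, h₂, rfl⟩ := hy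
      exact ⟨a₁ + a₂, fun j => add_mem (h₁ j) (h₂ j), by
        simp [add_mul, Finset.sum_add_distrib]⟩
    | smul z y _ hy =>
      obtain ⟨a₁, h₁, rfl⟩ := hy
      -- `c` is the matrix of multiplication by `z`; its entries come from the base ring, so it
      -- keeps coordinates in `I`.
      choose c hc using fun j => hbij.2 (z * b j)
      refine ⟨fun k => ∑ j, a₁ j * c j k, fun k => Ideal.sum_mem _ fun j _ =>
        Ideal.mul_mem_right _ _ (h₁ j), ?_⟩
      simp only [map_sum, map_mul, Finset.sum_mul, smul_eq_mul, Finset.mul_sum]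
      rw [Finset.sum_comm]
      refine Finset.sum_congr rfl fun j _ => ?_
      have := congrArg (φ (a₁ j) * ·) (hc j)
      simp only [Finset.mul_sum] at this
      rw [show z * (φ (a₁ j) * b j) = φ (a₁ j) * (z * b j) by ring, ← this]
      exact Finset.sum_congr rfl fun k _ => by ring
  obtain ⟨a', h1, h2⟩ := key _ h
  rw [← hbij.1 h2]
  exact h1

/-- The Hilbert series of a graded free extension with homogeneous basis `b`. -/
theorem hilb_map_of_free [Finite σ] (hw : ∀ x, w x ≠ 0) {ι : Type} [Fintype ι]
    (φ : MvPolynomial σ ℂ →ₐ[ℂ] MvPolynomial σ' ℂ)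
    (hφ : ∀ x, IsWeightedHomogeneous w' (φ (MvPolynomial.X x)) (w x))
    (b : ι → MvPolynomial σ' ℂ) (d : ι → ℕ) (hb : ∀ j, IsWeightedHomogeneous w' (b j) (d j))
    (hbij : Function.Bijective fun a : ι → MvPolynomial σ ℂ => ∑ j, φ (a j) * b j)
    (I : Ideal (MvPolynomial σ ℂ)) :
    hilb w' (I.map φ) = hilb w I * ∑ j, (PowerSeries.X : PowerSeries ℚ) ^ d j := by
  ext n
  rw [Finset.mul_sum, map_sum]
  simp only [PowerSeries.coeff_mul_X_pow', hilb, PowerSeries.coeff_mk]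
  have hfin : ∀ j, Module.Finite ℂ (shiftPart w n (d j)) := fun j => finite_shiftPart hw n (d j)
  -- From tuples of coefficients of complementary weights, `S` builds the element of weight `n`,
  -- while `G` reduces each coefficient modulo `I`. By `sum_mul_mem_map_iff`, `S` followed by the
  -- quotient map has the same kernel as `G`.
  let g : ∀ j, shiftPart w n (d j) →ₗ[ℂ] MvPolynomial σ ℂ ⧸ I := fun j =>
    (Ideal.Quotient.mkₐ ℂ I).toLinearMap ∘ₗ (shiftPart w n (d j)).subtype
  let G : (∀ j, shiftPart w n (d j)) →ₗ[ℂ] (∀ j, LinearMap.range (g j)) :=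
    LinearMap.pi fun j => (g j).rangeRestrict ∘ₗ LinearMap.proj j
  let S : (∀ j, shiftPart w n (d j)) →ₗ[ℂ] MvPolynomial σ' ℂ :=
    ∑ j, LinearMap.mulRight ℂ (b j) ∘ₗ φ.toLinearMap ∘ₗ (shiftPart w n (d j)).subtype ∘ₗ
      LinearMap.proj j
  have hS : ∀ a, S a = ∑ j, φ (a j : MvPolynomial σ ℂ) * b j := fun a => by simp [S]
  have hSr : LinearMap.range S = weightedHomogeneousSubmodule ℂ w' n := by
    refine le_antisymm ?_ fun y hy => ?_
    · rintro _ ⟨a, rfl⟩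
      rw [hS]
      refine Submodule.sum_mem _ fun j _ => ?_
      have := (a j).2
      by_cases hj : d j ≤ n
      · simp only [shiftPart, if_pos hj] at this
        have h := (isWeightedHomogeneous_aeval hφ this).mul (hb j)
        rwa [Nat.sub_add_cancel hj] at h
      · simp only [shiftPart, if_neg hj, Submodule.mem_bot] at this
        rw [this, map_zero, zero_mul]
        exact zero_mem _
    -- A homogeneous element equals its own component, so its coefficients may be exchanged for
    -- homogeneous ones.
    · obtain ⟨a, rfl⟩ := hbij.2 y
      choose a' ha' he using fun j => exists_component_mul hφ (hb j) n (a j)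
      refine ⟨fun j => ⟨a' j, ha' j⟩, ?_⟩
      rw [hS]
      have := MvPolynomial.IsWeightedHomogeneous.weightedHomogeneousComponent_same hy
      rw [← this, map_sum]
      exact Finset.sum_congr rfl fun j _ => (he j).symm
  have hG : LinearMap.range G = ⊤ := by
    refine LinearMap.range_eq_top.2 fun y => ?_
    choose x hx using fun j => (g j).surjective_rangeRestrict (y j)
    exact ⟨x, funext hx⟩
  have h1 : quotPart w' (I.map φ) n
      = LinearMap.range ((Ideal.Quotient.mkₐ ℂ (I.map φ)).toLinearMap ∘ₗ S) := by
    rw [LinearMap.range_comp, hSr, quotPart]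
  rw [h1, finrank_range_eq_of_ker_eq _ G, hG, finrank_top, Module.finrank_pi_fintype, Nat.cast_sum]
  · refine Finset.sum_congr rfl fun j _ => ?_
    rw [show LinearMap.range (g j) = (shiftPart w n (d j)).map
      (Ideal.Quotient.mkₐ ℂ I).toLinearMap by
        rw [LinearMap.range_comp, Submodule.range_subtype]]
    by_cases hj : d j ≤ n
    · rw [shiftPart, if_pos hj, if_pos hj, quotPart]
    · rw [shiftPart, if_neg hj, if_neg hj, Submodule.map_bot, finrank_bot, Nat.cast_zero]
  · ext a
    rw [LinearMap.mem_ker, LinearMap.mem_ker, LinearMap.comp_apply, hS, AlgHom.toLinearMap_apply,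
      Ideal.Quotient.mkₐ_eq_mk, Ideal.Quotient.eq_zero_iff_mem]
    refine (sum_mul_mem_map_iff (φ : MvPolynomial σ ℂ →+* MvPolynomial σ' ℂ) b hbij I
      fun j => (a j : MvPolynomial σ ℂ)).trans ?_
    rw [funext_iff]
    refine forall_congr' fun j => ?_
    rw [← Ideal.Quotient.eq_zero_iff_mem, ← Subtype.coe_inj]
    rfl

/-- The Hilbert series of a weighted hypersurface. -/
theorem hilb_span_singleton [Finite σ] (hw : ∀ x, w x ≠ 0) {f : MvPolynomial σ ℂ} (hf0 : f ≠ 0)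
    {d : ℕ} (hf : IsWeightedHomogeneous w f d) :
    hilb w (Ideal.span {f}) = hilb w ⊥ * (1 - PowerSeries.X ^ d) := by
  ext n
  rw [mul_sub, mul_one, map_sub, PowerSeries.coeff_mul_X_pow']
  simp only [hilb, PowerSeries.coeff_mk]
  have hbot : ∀ m, Module.finrank ℂ (quotPart w ⊥ m)
      = Module.finrank ℂ (weightedHomogeneousSubmodule ℂ w m) := by
    intro m
    rw [quotPart_eq_range]
    refine LinearMap.finrank_range_of_inj fun x y hxy => ?_
    rw [← sub_eq_zero, ← map_sub] at hxy
    have := Ideal.Quotient.eq_zero_iff_mem.1 hxy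
    rw [Ideal.mem_bot] at this
    exact sub_eq_zero.1 (Subtype.ext this)
  have := finite_part hw n
  have hfin := finite_shiftPart hw n d
  let Q := (Ideal.Quotient.mkₐ ℂ (Ideal.span {f})).toLinearMap ∘ₗ
    (weightedHomogeneousSubmodule ℂ w n).subtype
  have h1 := Q.finrank_range_add_finrank_ker
  -- Multiplication by `f` is injective and its image is the kernel of `Q`, so rank-nullity gives
  -- the formula.
  let T : shiftPart w n d →ₗ[ℂ] weightedHomogeneousSubmodule ℂ w n :=
    LinearMap.codRestrict _ (LinearMap.mulRight ℂ f ∘ₗ (shiftPart w n d).subtype) (by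
      intro a
      have ha := a.2
      by_cases hj : d ≤ n
      · simp only [shiftPart, if_pos hj] at ha
        have h := MvPolynomial.IsWeightedHomogeneous.mul ha hf
        rwa [Nat.sub_add_cancel hj] at h
      · simp only [shiftPart, if_neg hj, Submodule.mem_bot] at ha
        simp [ha])
  have hT : ∀ a, ((T a : weightedHomogeneousSubmodule ℂ w n) : MvPolynomial σ ℂ) = a * f :=
    fun a => rfl
  have hTinj : Function.Injective T := fun x y hxy => by
    have := congrArg Subtype.val hxy
    rw [hT, hT] at this
    exact Subtype.ext (mul_right_cancel₀ hf0 this)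
  have hTQ : LinearMap.range T = LinearMap.ker Q := by
    ext y
    have hyQ : y ∈ LinearMap.ker Q ↔ (y : MvPolynomial σ ℂ) ∈ Ideal.span {f} :=
      Ideal.Quotient.eq_zero_iff_mem
    rw [hyQ, Ideal.mem_span_singleton']
    constructor
    · rintro ⟨a, rfl⟩
      exact ⟨a, rfl⟩
    · rintro ⟨a, ha⟩
      -- The multiplier of `f` may be taken homogeneous of weight `n - d`, by comparing components
      -- of weight `n`.
      obtain ⟨a', ha', he⟩ := exists_component_mul (φ := AlgHom.id ℂ _)
        (MvPolynomial.isWeightedHomogeneous_X ℂ w) hf n a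
      refine ⟨⟨a', ha'⟩, Subtype.ext ?_⟩
      rw [hT, ← MvPolynomial.IsWeightedHomogeneous.weightedHomogeneousComponent_same y.2, ← ha]
      exact he.symm
  rw [← hTQ, LinearMap.finrank_range_of_inj hTinj] at h1
  rw [hbot, hbot, ← h1, quotPart_eq_range, Nat.cast_add, add_sub_assoc]
  symm
  rw [add_eq_left, sub_eq_zero]
  by_cases hj : d ≤ n
  · rw [shiftPart, if_pos hj, if_pos hj]
  · rw [shiftPart, if_neg hj, if_neg hj, finrank_bot, Nat.cast_zero]

/-- The Hilbert series of a polynomial ring with generators of weights `1, …, m`. -/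
theorem hilb_bot_fin (m : ℕ) :
    hilb (fun i : Fin m => m - (i : ℕ)) ⊥ * ∏ i ∈ Finset.range m, (1 - PowerSeries.X ^ (i + 1))
      = 1 := by
  induction m with
  | zero =>
    ext n
    rw [Finset.range_zero, Finset.prod_empty, mul_one, hilb, PowerSeries.coeff_mk,
      PowerSeries.coeff_one]
    split_ifs with hn
    · subst hn
      rw [Nat.cast_eq_one, finrank_eq_one_iff']
      refine ⟨⟨1, 1, MvPolynomial.isWeightedHomogeneous_one _ _,
        map_one (Ideal.Quotient.mkₐ ℂ (⊥ : Ideal (MvPolynomial (Fin 0) ℂ)))⟩, fun h => ?_, ?_⟩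
      · have h' := congrArg Subtype.val h
        have := (Ideal.Quotient.eq_zero_iff_mem (I := (⊥ : Ideal (MvPolynomial (Fin 0) ℂ)))).1 h'
        exact one_ne_zero (Ideal.mem_bot.1 this)
      · rintro ⟨_, p, _, rfl⟩
        refine ⟨p.coeff 0, Subtype.ext ?_⟩
        have hp := congrArg (Ideal.Quotient.mkₐ ℂ (⊥ : Ideal (MvPolynomial (Fin 0) ℂ)))
          (MvPolynomial.eq_C_of_isEmpty p)
        refine Eq.trans ?_ hp.symm
        rw [← MvPolynomial.algebraMap_eq, AlgHom.commutes, Algebra.algebraMap_eq_smul_one]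
        rfl
    · rw [Nat.cast_eq_zero]
      have : quotPart (fun i : Fin 0 => 0 - (i : ℕ)) ⊥ n = ⊥ := by
        refine (Submodule.eq_bot_iff _).2 ?_
        rintro _ ⟨p, hp, rfl⟩
        by_contra h
        have hp0 : p ≠ 0 := fun h0 => h (by rw [h0, map_zero])
        exact hn (MvPolynomial.IsWeightedHomogeneous.inj_right hp0 hp
          (MvPolynomial.isWeightedHomogeneous_of_isEmpty ℂ _ p))
      rw [this, finrank_bot]
  | succ m ih =>
    let π : MvPolynomial (Fin (m + 1)) ℂ →ₐ[ℂ] MvPolynomial (Fin m) ℂ :=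
      MvPolynomial.aeval (Fin.cases 0 MvPolynomial.X)
    let s : MvPolynomial (Fin m) ℂ →ₐ[ℂ] MvPolynomial (Fin (m + 1)) ℂ :=
      MvPolynomial.rename Fin.succ
    -- Variable `0` is the heaviest, of weight `m + 1`. Killing it leaves the ring with weights `m,
    -- …, 1`, and the hypersurface formula relates the two series.
    have hJ : Ideal.span {MvPolynomial.X 0} = (⊥ : Ideal (MvPolynomial (Fin m) ℂ)).comap π := by
      refine eq_comap_of_retraction π s ?_ bot_le ?_
      · rw [Ideal.span_singleton_le_iff_mem]
        simp [π]
      · refine MvPolynomial.algHom_ext fun i => ?_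
        refine Fin.cases ?_ (fun i => ?_) i
        · have : Ideal.Quotient.mkₐ ℂ (Ideal.span {(MvPolynomial.X 0 :
              MvPolynomial (Fin (m + 1)) ℂ)}) (MvPolynomial.X 0) = 0 :=
            Ideal.Quotient.eq_zero_iff_mem.2 (Ideal.mem_span_singleton_self _)
          rw [this]
          simp [π]
        · simp [π, s]
    have h1 := hilb_span_singleton (w := fun i : Fin (m + 1) => m + 1 - (i : ℕ))
      (fun i => by omega) (MvPolynomial.X_ne_zero (0 : Fin (m + 1)))
      (MvPolynomial.isWeightedHomogeneous_X ℂ _ 0)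
    rw [hJ, hilb_comap (w' := fun i : Fin m => m - (i : ℕ)) π s] at h1
    · rw [h1] at ih
      simp only [Fin.val_zero, Nat.sub_zero] at ih
      rw [Finset.prod_range_succ]
      linear_combination ih
    · refine Fin.cases ?_ fun i => ?_
      · simpa [π] using MvPolynomial.isWeightedHomogeneous_zero _ _ _
      · simpa [π] using MvPolynomial.isWeightedHomogeneous_X ℂ (fun i : Fin m => m - (i : ℕ)) i
    · intro i
      simpa [s] using MvPolynomial.isWeightedHomogeneous_X ℂ
        (fun i : Fin (m + 1) => m + 1 - (i : ℕ)) i.succ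
    · intro i
      simp [π, s]

end Hilbert

/-! ### Monic polynomials with indeterminate coefficients -/

section Monic

variable {A B : Type} [CommRing A] [CommRing B]

/-- The monic polynomial of degree `n` with given lower coefficients. -/
def monicOf {n : ℕ} (f : Fin n → A) : A[X] := X ^ n + ∑ i : Fin n, C (f i) * X ^ (i : ℕ)

lemma monicOf_monic {n : ℕ} (f : Fin n → A) : (monicOf f).Monic :=
  monic_X_pow_add (degree_sum_fin_lt f)

lemma natDegree_monicOf [Nontrivial A] {n : ℕ} (f : Fin n → A) : (monicOf f).natDegree = n := by
  rw [monicOf, natDegree_add_eq_left_of_degree_lt, natDegree_X_pow]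
  rw [degree_X_pow]
  exact degree_sum_fin_lt f

lemma coeff_monicOf {n : ℕ} (f : Fin n → A) (i : Fin n) : (monicOf f).coeff i = f i := by
  rw [monicOf, coeff_add, coeff_X_pow, if_neg (by omega), zero_add, finsetSum_coeff,
    Finset.sum_eq_single_of_mem i (Finset.mem_univ _)]
  · simp
  · intro j _ hj
    rw [coeff_C_mul, coeff_X_pow, if_neg (fun h => hj (Fin.ext h.symm)), mul_zero]

lemma map_monicOf {n : ℕ} (φ : A →+* B) (f : Fin n → A) :
    (monicOf f).map φ = monicOf fun i => φ (f i) := by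
  simp [monicOf, Polynomial.map_sum]

lemma monicOf_coeff {p : A[X]} (hp : p.Monic) {n : ℕ} (hn : p.natDegree = n) :
    monicOf (fun i : Fin n => p.coeff i) = p := by
  subst hn
  conv_rhs => rw [hp.as_sum, Finset.sum_range]
  rfl

variable {σ τ : Type}

/-- The generic monic polynomial of degree `n`. -/
def genPoly (n : ℕ) (τ : Type) : (MvPolynomial (Fin n ⊕ τ) ℂ)[X] :=
  monicOf fun i => MvPolynomial.X (Sum.inl i)

/-- The weights of the coefficients of the generic monic polynomial of degree `n`, and of further
variables. -/
def monicWeight (n : ℕ) (w : τ → ℕ) : Fin n ⊕ τ → ℕ := Sum.elim (fun i => n - i) w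

lemma monicWeight_ne_zero {n : ℕ} {w : τ → ℕ} (hw : ∀ x, w x ≠ 0) (x : Fin n ⊕ τ) :
    monicWeight n w x ≠ 0 := by
  rcases x with i | x
  · simp only [monicWeight, Sum.elim_inl]
    omega
  · exact hw x

/-- The algebra homomorphism that specialises the generic monic polynomial of degree `n` to `p`,
and the other variables to `f`. -/
def specialise [Algebra ℂ B] (n : ℕ) (p : B[X]) (f : τ → B) : MvPolynomial (Fin n ⊕ τ) ℂ →ₐ[ℂ] B :=
  MvPolynomial.aeval (Sum.elim (fun i => p.coeff i) f)

lemma specialise_inl [Algebra ℂ B] (n : ℕ) (p : B[X]) (f : τ → B) (i : Fin n) :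
    specialise n p f (MvPolynomial.X (Sum.inl i)) = p.coeff i := by
  simp [specialise]

lemma specialise_inr [Algebra ℂ B] (n : ℕ) (p : B[X]) (f : τ → B) (z : τ) :
    specialise n p f (MvPolynomial.X (Sum.inr z)) = f z := by
  simp [specialise]

/-- Existence half of the universal property of the generic monic polynomial. -/
lemma map_genPoly [Algebra ℂ B] {n : ℕ} {p : B[X]} (f : τ → B) (hp : p.Monic)
    (hn : p.natDegree = n) :
    (genPoly n τ).map (specialise n p f : MvPolynomial (Fin n ⊕ τ) ℂ →+* B) = p := by
  rw [genPoly, map_monicOf]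
  simp only [AlgHom.coe_toRingHom, specialise_inl]
  exact monicOf_coeff hp hn

/-- Uniqueness half of the universal property: composites are compared through one polynomial
identity, without formulas for single coefficients. -/
lemma algHom_ext_of_genPoly [Algebra ℂ B] {n : ℕ} {φ ψ : MvPolynomial (Fin n ⊕ τ) ℂ →ₐ[ℂ] B}
    (h : (genPoly n τ).map (φ : MvPolynomial (Fin n ⊕ τ) ℂ →+* B)
      = (genPoly n τ).map (ψ : MvPolynomial (Fin n ⊕ τ) ℂ →+* B))
    (h' : ∀ z, φ (MvPolynomial.X (Sum.inr z)) = ψ (MvPolynomial.X (Sum.inr z))) : φ = ψ := by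
  refine MvPolynomial.algHom_ext fun x => ?_
  rcases x with i | z
  · have := congrArg (fun q => q.coeff (i : ℕ)) h
    simpa only [genPoly, map_monicOf, coeff_monicOf, AlgHom.coe_toRingHom] using this
  · exact h' z

/-- Polynomials that are homogeneous of degree `N`, if the variable has weight `1`. -/
def IsHomogPoly (w : σ → ℕ) (N : ℕ) (p : (MvPolynomial σ ℂ)[X]) : Prop :=
  (∀ i j, i + j = N → IsWeightedHomogeneous w (p.coeff i) j) ∧ ∀ i, N < i → p.coeff i = 0

lemma IsHomogPoly.mul {w : σ → ℕ} {N M : ℕ} {p q : (MvPolynomial σ ℂ)[X]}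
    (hp : IsHomogPoly w N p) (hq : IsHomogPoly w M q) : IsHomogPoly w (N + M) (p * q) := by
  refine ⟨fun i j hij => ?_, fun i hi => ?_⟩
  · rw [coeff_mul]
    refine MvPolynomial.IsWeightedHomogeneous.sum _ _ _ fun x hx => ?_
    rw [Finset.HasAntidiagonal.mem_antidiagonal] at hx
    rcases lt_or_ge N x.1 with h | h
    · rw [hp.2 _ h, zero_mul]
      exact MvPolynomial.isWeightedHomogeneous_zero _ _ _
    rcases lt_or_ge M x.2 with h' | h'
    · rw [hq.2 _ h', mul_zero]
      exact MvPolynomial.isWeightedHomogeneous_zero _ _ _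
    have := (hp.1 x.1 (N - x.1) (by omega)).mul (hq.1 x.2 (M - x.2) (by omega))
    rwa [show N - x.1 + (M - x.2) = j by omega] at this
  · rw [coeff_mul]
    refine Finset.sum_eq_zero fun x hx => ?_
    rw [Finset.HasAntidiagonal.mem_antidiagonal] at hx
    rcases lt_or_ge N x.1 with h | h
    · rw [hp.2 _ h, zero_mul]
    · rw [hq.2 _ (by omega), mul_zero]

lemma IsHomogPoly.sub {w : σ → ℕ} {N : ℕ} {p q : (MvPolynomial σ ℂ)[X]}
    (hp : IsHomogPoly w N p) (hq : IsHomogPoly w N q) : IsHomogPoly w N (p - q) := by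
  refine ⟨fun i j hij => ?_, fun i hi => ?_⟩
  · rw [coeff_sub]
    exact (hp.1 i j hij).sub (hq.1 i j hij)
  · rw [coeff_sub, hp.2 i hi, hq.2 i hi, sub_zero]

lemma IsHomogPoly.X_pow (w : σ → ℕ) (N : ℕ) : IsHomogPoly w N (X ^ N) := by
  refine ⟨fun i j hij => ?_, fun i hi => ?_⟩
  · rw [coeff_X_pow]
    split_ifs with h
    · rw [show j = 0 by omega]
      exact MvPolynomial.isWeightedHomogeneous_one _ _
    · exact MvPolynomial.isWeightedHomogeneous_zero _ _ _
  · rw [coeff_X_pow, if_neg (by omega)]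

lemma IsHomogPoly.C_mul_X_pow {w : σ → ℕ} {a : MvPolynomial σ ℂ} {k m : ℕ}
    (ha : IsWeightedHomogeneous w a k) : IsHomogPoly w (m + k) (C a * X ^ m) := by
  refine ⟨fun i j hij => ?_, fun i hi => ?_⟩
  · rw [coeff_C_mul, coeff_X_pow]
    split_ifs with h
    · rwa [mul_one, show j = k by omega]
    · rw [mul_zero]
      exact MvPolynomial.isWeightedHomogeneous_zero _ _ _
  · rw [coeff_C_mul, coeff_X_pow, if_neg (by omega), mul_zero]

lemma IsHomogPoly.sum {ι : Type} [Fintype ι] {w : σ → ℕ} {N : ℕ} {p : ι → (MvPolynomial σ ℂ)[X]}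
    (hp : ∀ k, IsHomogPoly w N (p k)) : IsHomogPoly w N (∑ k, p k) := by
  refine ⟨fun i j hij => ?_, fun i hi => ?_⟩
  · rw [finsetSum_coeff]
    exact MvPolynomial.IsWeightedHomogeneous.sum _ _ _ fun k _ => (hp k).1 i j hij
  · rw [finsetSum_coeff]
    exact Finset.sum_eq_zero fun k _ => (hp k).2 i hi

lemma IsHomogPoly.monicOf {w : σ → ℕ} {n : ℕ} {f : Fin n → MvPolynomial σ ℂ}
    (hf : ∀ i, IsWeightedHomogeneous w (f i) (n - i)) : IsHomogPoly w n (monicOf f) := by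
  have h1 := IsHomogPoly.X_pow w n
  have h2 : IsHomogPoly w n (∑ i : Fin n, C (f i) * X ^ (i : ℕ)) := IsHomogPoly.sum fun i => by
    have := IsHomogPoly.C_mul_X_pow (m := i) (hf i)
    rwa [show (i : ℕ) + (n - i) = n by omega] at this
  refine ⟨fun i j hij => ?_, fun i hi => ?_⟩
  · rw [HyperellipticPrym.monicOf, coeff_add]
    exact (h1.1 i j hij).add (h2.1 i j hij)
  · rw [HyperellipticPrym.monicOf, coeff_add, h1.2 i hi, h2.2 i hi, add_zero]

lemma isHomogPoly_genPoly {n : ℕ} (w : τ → ℕ) :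
    IsHomogPoly (monicWeight n w) n (genPoly n τ) :=
  IsHomogPoly.monicOf fun i => MvPolynomial.isWeightedHomogeneous_X ℂ (monicWeight n w) (Sum.inl i)

lemma isWeightedHomogeneous_specialise {w : τ → ℕ} {w' : σ → ℕ} {n : ℕ}
    {p : (MvPolynomial σ ℂ)[X]} {f : τ → MvPolynomial σ ℂ} (hp : IsHomogPoly w' n p)
    (hf : ∀ z, IsWeightedHomogeneous w' (f z) (w z)) (x : Fin n ⊕ τ) :
    IsWeightedHomogeneous w' (specialise n p f (MvPolynomial.X x)) (monicWeight n w x) := by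
  rcases x with i | z
  · rw [specialise_inl]
    exact hp.1 i _ (by simp only [monicWeight, Sum.elim_inl]; omega)
  · rw [specialise_inr]
    exact hf z

end Monic

/-! ### Adjoining a root of the generic monic polynomial -/

section Root

variable {τ τ' : Type} (e : Option τ ≃ τ') (n : ℕ)

/-- The polynomial `(y - t) u'(y)`, where `u'` is the generic monic polynomial of degree `n` and `t`
is one of the other variables. -/
def rootPoly : (MvPolynomial (Fin n ⊕ τ') ℂ)[X] :=
  (X - C (MvPolynomial.X (Sum.inr (e none)))) * genPoly n τ'

/-- The homomorphism that adjoins a root `t` of the generic monic polynomial of degree `n + 1`: it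
maps this polynomial to `(y - t) u'(y)`. -/
def adjoinRootHom : MvPolynomial (Fin (n + 1) ⊕ τ) ℂ →ₐ[ℂ] MvPolynomial (Fin n ⊕ τ') ℂ :=
  specialise (n + 1) (rootPoly e n) fun z => MvPolynomial.X (Sum.inr (e (some z)))

lemma rootPoly_monic : (rootPoly e n).Monic := (monic_X_sub_C _).mul (monicOf_monic _)

lemma natDegree_rootPoly : (rootPoly e n).natDegree = n + 1 := by
  rw [rootPoly, genPoly, (monic_X_sub_C _).natDegree_mul (monicOf_monic _), natDegree_X_sub_C,
    natDegree_monicOf, add_comm]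

lemma map_adjoinRootHom : (genPoly (n + 1) τ).map
    (adjoinRootHom e n : MvPolynomial (Fin (n + 1) ⊕ τ) ℂ →+* MvPolynomial (Fin n ⊕ τ') ℂ)
      = rootPoly e n :=
  map_genPoly _ (rootPoly_monic e n) (natDegree_rootPoly e n)

/-- Horner's scheme recovers the coefficients of `u'` from `t` and the coefficients of `(y - t) u'`,
starting from the top. Hence `t` generates the extension. -/
lemma adjoinRootHom_surjective (y : MvPolynomial (Fin n ⊕ τ') ℂ) :
    ∃ q : (MvPolynomial (Fin (n + 1) ⊕ τ) ℂ)[X],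
      q.eval₂ (adjoinRootHom e n : MvPolynomial (Fin (n + 1) ⊕ τ) ℂ →+* MvPolynomial (Fin n ⊕ τ') ℂ)
        (MvPolynomial.X (Sum.inr (e none))) = y := by
  set t : MvPolynomial (Fin n ⊕ τ') ℂ := MvPolynomial.X (Sum.inr (e none)) with ht
  set φ : MvPolynomial (Fin (n + 1) ⊕ τ) ℂ →+* MvPolynomial (Fin n ⊕ τ') ℂ :=
    (adjoinRootHom e n : MvPolynomial (Fin (n + 1) ⊕ τ) ℂ →+* MvPolynomial (Fin n ⊕ τ') ℂ) with hφ
  change y ∈ (eval₂RingHom φ t).range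
  have hbase : ∀ a, φ a ∈ (eval₂RingHom φ t).range := fun a => ⟨C a, by simp⟩
  have htmem : t ∈ (eval₂RingHom φ t).range := ⟨X, by simp⟩
  have hu : ∀ k : ℕ, (genPoly n τ').coeff k ∈ (eval₂RingHom φ t).range := by
    intro k
    have hrec : ∀ k, (genPoly n τ').coeff k
        = (rootPoly e n).coeff (k + 1) + t * (genPoly n τ').coeff (k + 1) := by
      intro k
      rw [rootPoly, sub_mul, coeff_sub, coeff_X_mul, coeff_C_mul]
      ring
    -- Descending induction on `k`; it starts above the degree, where the coefficients vanish.
    have hdown : ∀ d k, n < k + d → (genPoly n τ').coeff k ∈ (eval₂RingHom φ t).range := by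
      intro d
      induction d with
      | zero =>
        intro k hk
        rw [coeff_eq_zero_of_natDegree_lt (by rw [genPoly, natDegree_monicOf]; omega)]
        exact zero_mem _
      | succ d ih =>
        intro k hk
        rw [hrec, ← map_adjoinRootHom, coeff_map]
        exact add_mem (hbase _) (mul_mem htmem (ih (k + 1) (by omega)))
    exact hdown (n + 1) k (by omega)
  induction y using MvPolynomial.induction_on with
  | C r =>
    have := hbase (MvPolynomial.C r)
    rwa [hφ, ← MvPolynomial.algebraMap_eq, AlgHom.coe_toRingHom, AlgHom.commutes] at this
  | add p q hp hq => exact add_mem hp hq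
  | mul_X p x hp =>
    refine mul_mem hp ?_
    rcases x with i | z
    · have := hu i
      rwa [genPoly, coeff_monicOf] at this
    · obtain ⟨z, rfl⟩ := e.surjective z
      cases z with
      | none => exact htmem
      | some z =>
        have := hbase (MvPolynomial.X (Sum.inr z))
        rwa [hφ, AlgHom.coe_toRingHom, adjoinRootHom, specialise_inr] at this

/-- Over `AdjoinRoot U` the polynomial `U` splits as `(X - r) p` with `p` monic of degree `n`. The
universal property then gives a homomorphism `ψ` that sends `t` to `r` and extends the structure map
of the base. So a relation satisfied by `t` is also satisfied by `r`, and those are the multiples of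
`U`. -/
lemma genPoly_dvd_of_eval₂_eq_zero {q : (MvPolynomial (Fin (n + 1) ⊕ τ) ℂ)[X]}
    (hq : q.eval₂ (adjoinRootHom e n : MvPolynomial (Fin (n + 1) ⊕ τ) ℂ →+* MvPolynomial (Fin n ⊕ τ') ℂ)
      (MvPolynomial.X (Sum.inr (e none))) = 0) : genPoly (n + 1) τ ∣ q := by
  set U := genPoly (n + 1) τ with hU
  have hUm : U.Monic := monicOf_monic _
  have hUd : U.natDegree = n + 1 := by rw [hU, genPoly, natDegree_monicOf]
  let ι : MvPolynomial (Fin (n + 1) ⊕ τ) ℂ →ₐ[ℂ] AdjoinRoot U :=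
    Algebra.ofId (MvPolynomial (Fin (n + 1) ⊕ τ) ℂ) (AdjoinRoot U) |>.restrictScalars ℂ
  have hι : (ι : MvPolynomial (Fin (n + 1) ⊕ τ) ℂ →+* AdjoinRoot U) = AdjoinRoot.of U := rfl
  set r := AdjoinRoot.root U with hr
  set p := (U.map (AdjoinRoot.of U)) /ₘ (X - C r) with hp
  have : Nontrivial (AdjoinRoot U) := AdjoinRoot.nontrivial _ (by
    rw [degree_eq_natDegree hUm.ne_zero, hUd]
    exact_mod_cast Nat.succ_ne_zero n)
  have hmul : (X - C r) * p = U.map (AdjoinRoot.of U) :=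
    mul_divByMonic_eq_iff_isRoot.2 (by rw [IsRoot, eval_map, hr, AdjoinRoot.eval₂_root])
  have hpm : p.Monic := (monic_X_sub_C r).of_mul_monic_left (by rw [hmul]; exact hUm.map _)
  have hpd : p.natDegree = n := by
    have h1 := congrArg natDegree hmul
    rw [(monic_X_sub_C r).natDegree_mul hpm, hUm.natDegree_map, natDegree_X_sub_C, hUd] at h1
    omega
  let ψ : MvPolynomial (Fin n ⊕ τ') ℂ →ₐ[ℂ] AdjoinRoot U := specialise n p fun z =>
    (e.symm z).elim r fun z => AdjoinRoot.of U (MvPolynomial.X (Sum.inr z))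
  have hψt : ψ (MvPolynomial.X (Sum.inr (e none))) = r := by
    simp [ψ, specialise_inr]
  have hψφ : ψ.comp (adjoinRootHom e n) = ι := by
    refine algHom_ext_of_genPoly ?_ fun z => ?_
    · rw [hι, AlgHom.comp_toRingHom, ← Polynomial.map_map, map_adjoinRootHom, rootPoly,
        Polynomial.map_mul, Polynomial.map_sub, map_X, map_C, map_genPoly _ hpm hpd, ← hU, ← hmul,
        AlgHom.coe_toRingHom, hψt]
    · rw [AlgHom.comp_apply, adjoinRootHom, specialise_inr]
      simp only [ψ]
      rw [specialise_inr, Equiv.symm_apply_apply]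
      rfl
  have h1 := congrArg (ψ : MvPolynomial (Fin n ⊕ τ') ℂ →+* AdjoinRoot U) hq
  rw [hom_eval₂, ← AlgHom.comp_toRingHom, hψφ, hι, AlgHom.coe_toRingHom, hψt, map_zero] at h1
  rw [← AdjoinRoot.mk_eq_zero, ← h1, ← AdjoinRoot.aeval_eq, aeval_def]
  rfl

/-- The powers `1, t, …, t^n` are a basis: division by the generic polynomial leaves a remainder of
degree at most `n`, and a nonzero such remainder is not divisible by it. -/
lemma adjoinRootHom_bijective : Function.Bijective
    fun a : Fin (n + 1) → MvPolynomial (Fin (n + 1) ⊕ τ) ℂ =>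
      ∑ j, adjoinRootHom e n (a j) *
        (MvPolynomial.X (Sum.inr (e none)) : MvPolynomial (Fin n ⊕ τ') ℂ) ^ (j : ℕ) := by
  have hUm : (genPoly (n + 1) τ).Monic := monicOf_monic _
  have hUd : (genPoly (n + 1) τ).natDegree = n + 1 := by rw [genPoly, natDegree_monicOf]
  have heval : ∀ a : Fin (n + 1) → MvPolynomial (Fin (n + 1) ⊕ τ) ℂ,
      (∑ j, C (a j) * X ^ (j : ℕ)).eval₂
        (adjoinRootHom e n : MvPolynomial (Fin (n + 1) ⊕ τ) ℂ →+* MvPolynomial (Fin n ⊕ τ') ℂ)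
        (MvPolynomial.X (Sum.inr (e none)) : MvPolynomial (Fin n ⊕ τ') ℂ)
      = ∑ j, adjoinRootHom e n (a j) * MvPolynomial.X (Sum.inr (e none)) ^ (j : ℕ) := by
    intro a
    simp [eval₂_finsetSum]
  constructor
  · intro a b hab
    have h0 : (∑ j, C ((a - b) j) * X ^ (j : ℕ)).eval₂
        (adjoinRootHom e n : MvPolynomial (Fin (n + 1) ⊕ τ) ℂ →+* MvPolynomial (Fin n ⊕ τ') ℂ)
        (MvPolynomial.X (Sum.inr (e none)) : MvPolynomial (Fin n ⊕ τ') ℂ) = 0 := by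
      rw [heval]
      simp only [Pi.sub_apply, map_sub, sub_mul, Finset.sum_sub_distrib]
      exact sub_eq_zero.2 hab
    have h1 := genPoly_dvd_of_eval₂_eq_zero e n h0
    have h2 := eq_zero_of_dvd_of_degree_lt h1 (by
      rw [degree_eq_natDegree hUm.ne_zero, hUd]
      exact degree_sum_fin_lt _)
    funext i
    -- The leading power is added to turn the sum into a `monicOf`, whose coefficients are known.
    have h3 := congrArg (fun q => (X ^ (n + 1) + q).coeff (i : ℕ)) h2
    simp only [add_zero] at h3
    change (monicOf (a - b)).coeff i = _ at h3
    rw [coeff_monicOf, coeff_X_pow, if_neg (by omega)] at h3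
    exact sub_eq_zero.1 h3
  · intro y
    obtain ⟨q, rfl⟩ := adjoinRootHom_surjective e n y
    refine ⟨fun j => (q %ₘ genPoly (n + 1) τ).coeff j, ?_⟩
    have hlt : (q %ₘ genPoly (n + 1) τ).natDegree < n + 1 := by
      have := natDegree_modByMonic_lt q hUm (fun h => by rw [h, natDegree_one] at hUd; omega)
      omega
    have hsum : q %ₘ genPoly (n + 1) τ
        = ∑ j : Fin (n + 1), C ((q %ₘ genPoly (n + 1) τ).coeff j) * X ^ (j : ℕ) := by
      conv_lhs => rw [as_sum_range_C_mul_X_pow' _ hlt, Finset.sum_range]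
    dsimp only
    rw [← heval, ← hsum]
    conv_rhs => rw [← modByMonic_add_div q (genPoly (n + 1) τ)]
    rw [eval₂_add, eval₂_mul, ← eval_map _ _ (p := genPoly (n + 1) τ), map_adjoinRootHom, rootPoly]
    simp

/-- The Hilbert series after adjoining a root. -/
theorem hilb_adjoinRootHom [Finite τ] {w : τ → ℕ} {w' : τ' → ℕ} (hw : ∀ z, w z ≠ 0)
    (h1 : w' (e none) = 1) (h2 : ∀ z, w' (e (some z)) = w z)
    (J : Ideal (MvPolynomial (Fin (n + 1) ⊕ τ) ℂ)) :
    hilb (monicWeight n w') (J.map (adjoinRootHom e n))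
      = hilb (monicWeight (n + 1) w) J * ∑ j ∈ Finset.range (n + 1), PowerSeries.X ^ j := by
  rw [Finset.sum_range]
  have ht : IsWeightedHomogeneous (monicWeight n w')
      (MvPolynomial.X (Sum.inr (e none)) : MvPolynomial (Fin n ⊕ τ') ℂ) 1 := by
    have := MvPolynomial.isWeightedHomogeneous_X ℂ (monicWeight n w') (Sum.inr (e none))
    rwa [show monicWeight n w' (Sum.inr (e none)) = 1 from h1] at this
  refine hilb_map_of_free (monicWeight_ne_zero hw) (adjoinRootHom e n)
    (isWeightedHomogeneous_specialise ?_ fun z => ?_) _ (fun j : Fin (n + 1) => (j : ℕ))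
    (fun j => ?_) (adjoinRootHom_bijective e n) J
  · rw [add_comm n 1]
    refine IsHomogPoly.mul ?_ (isHomogPoly_genPoly w')
    have h1 := IsHomogPoly.X_pow (monicWeight n w') 1
    have h2 := IsHomogPoly.C_mul_X_pow (m := 0) ht
    rw [pow_one] at h1
    rw [pow_zero, mul_one] at h2
    exact h1.sub h2
  · rw [← h2 z]
    exact MvPolynomial.isWeightedHomogeneous_X ℂ (monicWeight n w') (Sum.inr (e (some z)))
  · simpa using ht.pow (j : ℕ)

end Root

/-! ### The factorization of a monic polynomial -/

section Factorization

variable (n a b : ℕ) (τ : Type)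

/-- The product of the generic monic polynomials of degree `a` and `b`. -/
def prodPoly : (MvPolynomial (Fin a ⊕ (Fin b ⊕ τ)) ℂ)[X] :=
  genPoly a (Fin b ⊕ τ) * monicOf fun i => MvPolynomial.X (Sum.inr (Sum.inl i))

/-- The homomorphism that maps the generic monic polynomial of degree `n = a + b` to the product of
the generic monic polynomials of degree `a` and `b`. -/
def factorHom : MvPolynomial (Fin n ⊕ τ) ℂ →ₐ[ℂ] MvPolynomial (Fin a ⊕ (Fin b ⊕ τ)) ℂ :=
  specialise n (prodPoly a b τ) fun z => MvPolynomial.X (Sum.inr (Sum.inr z))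

lemma prodPoly_monic : (prodPoly a b τ).Monic := (monicOf_monic _).mul (monicOf_monic _)

lemma natDegree_prodPoly : (prodPoly a b τ).natDegree = a + b := by
  rw [prodPoly, genPoly, (monicOf_monic _).natDegree_mul (monicOf_monic _), natDegree_monicOf,
    natDegree_monicOf]

variable {n a b}

lemma map_factorHom (h : n = a + b) : (genPoly n τ).map
    (factorHom n a b τ : MvPolynomial (Fin n ⊕ τ) ℂ →+* _) = prodPoly a b τ :=
  map_genPoly _ (prodPoly_monic a b τ) ((natDegree_prodPoly a b τ).trans h.symm)

variable {τ}

/-- The Hilbert series of the factorizations of a monic polynomial. -/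
theorem hilb_factorHom (h : n = a + b) [Finite τ] {w : τ → ℕ} (hw : ∀ z, w z ≠ 0)
    (J : Ideal (MvPolynomial (Fin n ⊕ τ) ℂ)) :
    hilb (monicWeight a (monicWeight b w)) (J.map (factorHom n a b τ)) *
        ∏ k ∈ Finset.range a, ∑ j ∈ Finset.range (k + 1), PowerSeries.X ^ j
      = hilb (monicWeight n w) J *
        ∏ k ∈ Finset.range a, ∑ j ∈ Finset.range (b + k + 1), PowerSeries.X ^ j := by
  -- The set `τ` has to vary, since every adjoined root becomes a further variable.
  induction a generalizing n τ with
  | zero =>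
    -- With a first factor of degree `0` the homomorphism only relabels the variables: a free
    -- extension of rank one.
    obtain rfl : n = b := by omega
    have hφ : factorHom n 0 n τ = MvPolynomial.rename Sum.inr := by
      refine MvPolynomial.algHom_ext fun x => ?_
      rcases x with i | z
      · rw [factorHom, specialise_inl, prodPoly, genPoly, monicOf]
        simp [coeff_monicOf]
      · rw [factorHom, specialise_inr]
        simp
    have hbij : Function.Bijective (MvPolynomial.rename (Sum.inr : Fin n ⊕ τ → Fin 0 ⊕ (Fin n ⊕ τ)) :
        MvPolynomial _ ℂ →ₐ[ℂ] MvPolynomial _ ℂ) :=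
      (MvPolynomial.renameEquiv ℂ (Equiv.emptySum (Fin 0) (Fin n ⊕ τ)).symm).bijective
    have := hilb_map_of_free (monicWeight_ne_zero hw) (w' := monicWeight 0 (monicWeight n w))
      (ι := Unit) (MvPolynomial.rename (Sum.inr : Fin n ⊕ τ → Fin 0 ⊕ (Fin n ⊕ τ)))
      (fun x => ?_) (fun _ => 1) (fun _ => 0)
      (fun _ => MvPolynomial.isWeightedHomogeneous_one _ _) ?_ J
    · rw [hφ, this]
      simp
    · rw [MvPolynomial.rename_X]
      exact MvPolynomial.isWeightedHomogeneous_X ℂ _ _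
    · simp only [Finset.univ_unique, Finset.sum_singleton, mul_one]
      exact hbij.comp (Equiv.funUnique Unit _).bijective
  | succ a ih =>
    obtain ⟨n, rfl⟩ : ∃ m, n = m + 1 := ⟨n - 1, by omega⟩
    have hn : n = a + b := by omega
    -- The new root is stored beside `τ`, behind the coefficients of the second factor, so that both
    -- orders of construction end in the same ring.
    let e : Option (Fin b ⊕ τ) ≃ Fin b ⊕ Option τ :=
      { toFun := fun z => z.elim (Sum.inr none) (Sum.map id some)
        invFun := Sum.elim (fun i => some (Sum.inl i)) (Option.map Sum.inr)
        left_inv := by rintro (_ | _ | _) <;> rfl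
        right_inv := by rintro (_ | _ | _) <;> rfl }
    -- Factoring and then adjoining a root of the first factor, or adjoining a root and then
    -- factoring the cofactor: either way the generic polynomial becomes `y - t` times generic
    -- polynomials of degrees `a` and `b`.
    have hcomm : (adjoinRootHom e a).comp (factorHom (n + 1) (a + 1) b τ)
        = (factorHom n a b (Option τ)).comp (adjoinRootHom (Equiv.refl (Option τ)) n) := by
      refine algHom_ext_of_genPoly ?_ fun z => ?_
      · rw [AlgHom.comp_toRingHom, AlgHom.comp_toRingHom, ← Polynomial.map_map,
          ← Polynomial.map_map, map_factorHom _ h, map_adjoinRootHom, prodPoly, Polynomial.map_mul,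
          map_adjoinRootHom, rootPoly, rootPoly, Polynomial.map_mul, map_factorHom _ hn, prodPoly,
          map_monicOf, Polynomial.map_sub, map_X, map_C, mul_assoc]
        simp only [AlgHom.coe_toRingHom, adjoinRootHom, factorHom, specialise_inr]
        rfl
      · simp only [AlgHom.comp_apply, factorHom, adjoinRootHom, specialise_inr]
        rfl
    have hw' : ∀ z : Option τ, z.elim 1 w ≠ 0 := by
      rintro (_ | z)
      · exact one_ne_zero
      · exact hw z
    have h1 := hilb_adjoinRootHom e a (monicWeight_ne_zero hw)
      (w' := monicWeight b fun z : Option τ => z.elim 1 w) rfl (by rintro (_ | _) <;> rfl)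
      (J.map (factorHom (n + 1) (a + 1) b τ))
    have h2 := hilb_adjoinRootHom (Equiv.refl (Option τ)) n hw
      (w' := fun z : Option τ => z.elim 1 w) rfl (fun _ => rfl) J
    have h3 := ih hn hw' (J.map (adjoinRootHom (Equiv.refl (Option τ)) n))
    -- The Hilbert series of one extended ideal is now computed along both sides of the square.
    rw [Ideal.map_mapₐ, ← hcomm, ← Ideal.map_mapₐ, h1, h2] at h3
    rw [Finset.prod_range_succ, Finset.prod_range_succ, show b + a + 1 = n + 1 by omega]
    linear_combination h3

end Factorization

/-! ### The ideal of the coefficients of a polynomial -/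

section CoeffIdeal

variable {A B : Type} [CommRing A] [CommRing B]

/-- The ideal of the coefficients of a polynomial. -/
def coeffIdeal (p : A[X]) : Ideal A := Ideal.span (Set.range p.coeff)

lemma coeff_mem_coeffIdeal (p : A[X]) (n : ℕ) : p.coeff n ∈ coeffIdeal p :=
  Ideal.subset_span ⟨n, rfl⟩

lemma coeffIdeal_le {p : A[X]} {I : Ideal A} (h : ∀ n, p.coeff n ∈ I) : coeffIdeal p ≤ I := by
  refine Ideal.span_le.2 ?_
  rintro _ ⟨n, rfl⟩
  exact h n

lemma map_coeffIdeal (φ : A →+* B) (p : A[X]) : (coeffIdeal p).map φ = coeffIdeal (p.map φ) := by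
  rw [coeffIdeal, coeffIdeal, Ideal.map_span, ← Set.range_comp]
  congr 2
  funext n
  simp

lemma coeffIdeal_expand (p : A[X]) : coeffIdeal (expand A 2 p) = coeffIdeal p := by
  refine le_antisymm (coeffIdeal_le fun n => ?_) (coeffIdeal_le fun n => ?_)
  · rw [coeff_expand two_pos]
    split_ifs
    · exact coeff_mem_coeffIdeal _ _
    · exact zero_mem _
  · rw [← coeff_expand_mul two_pos p n]
    exact coeff_mem_coeffIdeal _ _

/-- Separates the lowest relation from the others, as case (II) requires. -/
lemma coeffIdeal_X_mul_add_C (p : A[X]) (a : A) :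
    coeffIdeal (X * p + C a) = coeffIdeal p ⊔ Ideal.span {a} := by
  refine le_antisymm (coeffIdeal_le fun n => ?_) (sup_le (coeffIdeal_le fun n => ?_) ?_)
  · cases n with
    | zero =>
      simpa using Ideal.mem_sup_right (Ideal.mem_span_singleton_self a)
    | succ n =>
      simpa using Ideal.mem_sup_left (coeff_mem_coeffIdeal p n)
  · have := coeff_mem_coeffIdeal (X * p + C a) (n + 1)
    rwa [coeff_add, coeff_X_mul, coeff_C_succ, add_zero] at this
  · rw [Ideal.span_singleton_le_iff_mem]
    have := coeff_mem_coeffIdeal (X * p + C a) 0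
    rwa [coeff_add, coeff_X_mul_zero, coeff_C_zero, zero_add] at this

end CoeffIdeal

/-- `(1 - q) (1 - q^2) ⋯ (1 - q^k)` as a power series. -/
def qProd (k : ℕ) : PowerSeries ℚ := ∏ i ∈ Finset.range k, (1 - PowerSeries.X ^ (i + 1))

/-! ### Specialising the generic monic polynomial -/

section Specialisation

variable {τ : Type}

/-- The ideal of the relations that specialise the generic monic polynomial of degree `n` to `p`,
together with the relation `e = 0`. -/
def specIdeal (n : ℕ) (p : (MvPolynomial τ ℂ)[X]) (e : MvPolynomial τ ℂ) :
    Ideal (MvPolynomial (Fin n ⊕ τ) ℂ) :=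
  coeffIdeal (genPoly n τ - p.map ((MvPolynomial.rename Sum.inr : MvPolynomial τ ℂ →ₐ[ℂ]
    MvPolynomial (Fin n ⊕ τ) ℂ) : MvPolynomial τ ℂ →+* MvPolynomial (Fin n ⊕ τ) ℂ)) ⊔
    Ideal.span {MvPolynomial.rename Sum.inr e}

/-- The relations eliminate the generic coefficients in favour of those of `p`, so only the
variables `τ` and the relation `e` survive in the quotient. -/
lemma specIdeal_eq_comap {n : ℕ} {p : (MvPolynomial τ ℂ)[X]} (hp : p.Monic) (hn : p.natDegree = n)
    (e : MvPolynomial τ ℂ) :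
    specIdeal n p e = (Ideal.span {e}).comap (specialise n p MvPolynomial.X) := by
  have hsec : (specialise n p MvPolynomial.X).comp (MvPolynomial.rename Sum.inr)
      = AlgHom.id ℂ (MvPolynomial τ ℂ) := by
    refine MvPolynomial.algHom_ext fun z => ?_
    simp [specialise_inr]
  refine eq_comap_of_retraction _ (MvPolynomial.rename Sum.inr) ?_ ?_ ?_
  · refine sup_le (coeffIdeal_le fun i => ?_) ?_
    · rw [Ideal.mem_comap, ← AlgHom.coe_toRingHom, ← coeff_map, Polynomial.map_sub,
        map_genPoly _ hp hn, Polynomial.map_map, ← AlgHom.comp_toRingHom, hsec]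
      simp
    · rw [Ideal.span_singleton_le_iff_mem, Ideal.mem_comap, ← AlgHom.comp_apply, hsec]
      exact Ideal.mem_span_singleton_self e
  · rw [Ideal.span_singleton_le_iff_mem, Ideal.mem_comap]
    exact Ideal.mem_sup_right (Ideal.mem_span_singleton_self _)
  · refine MvPolynomial.algHom_ext fun x => ?_
    rcases x with i | z
    · rw [AlgHom.comp_apply, AlgHom.comp_apply, specialise_inl, Ideal.Quotient.mkₐ_eq_mk,
        eq_comm, Ideal.Quotient.eq]
      refine Ideal.mem_sup_left ?_
      have := coeff_mem_coeffIdeal (genPoly n τ - p.map ((MvPolynomial.rename Sum.inr :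
        MvPolynomial τ ℂ →ₐ[ℂ] MvPolynomial (Fin n ⊕ τ) ℂ) :
        MvPolynomial τ ℂ →+* MvPolynomial (Fin n ⊕ τ) ℂ)) i
      rwa [coeff_sub, coeff_map, genPoly, coeff_monicOf] at this
    · rw [AlgHom.comp_apply, AlgHom.comp_apply, specialise_inr, MvPolynomial.rename_X]

lemma hilb_specIdeal {n : ℕ} {p : (MvPolynomial τ ℂ)[X]} (hp : p.Monic) (hn : p.natDegree = n)
    {w : τ → ℕ} (hpw : IsHomogPoly w n p) (e : MvPolynomial τ ℂ) :
    hilb (monicWeight n w) (specIdeal n p e) = hilb w (Ideal.span {e}) := by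
  rw [specIdeal_eq_comap hp hn]
  refine hilb_comap _ (MvPolynomial.rename Sum.inr)
    (isWeightedHomogeneous_specialise hpw (MvPolynomial.isWeightedHomogeneous_X ℂ w))
    (fun z => ?_) (fun z => ?_) _
  · rw [MvPolynomial.rename_X]
    exact MvPolynomial.isWeightedHomogeneous_X ℂ (monicWeight n w) (Sum.inr z)
  · rw [MvPolynomial.rename_X, specialise_inr]

lemma sum_range_X_pow_mul (k : ℕ) :
    (∑ j ∈ Finset.range k, (PowerSeries.X : PowerSeries ℚ) ^ j) * (1 - PowerSeries.X)
      = 1 - PowerSeries.X ^ k := by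
  have := geom_sum_mul (PowerSeries.X : PowerSeries ℚ) k
  linear_combination -this

/-- Multiplication by `(1 - q)^a` turns the sums `1 + q + ⋯ + q^{k-1}` of `hilb_factorHom` into `1 -
q^k`, and their quotient into a Gaussian binomial coefficient. Homogeneity of `p` makes the
specialisation graded. -/
lemma hilb_factorHom_specIdeal [Finite τ] {a b : ℕ} {p : (MvPolynomial τ ℂ)[X]} (hp : p.Monic)
    (hn : p.natDegree = a + b) {w : τ → ℕ} (hw : ∀ z, w z ≠ 0) (hpw : IsHomogPoly w (a + b) p)
    (e : MvPolynomial τ ℂ) :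
    hilb (monicWeight a (monicWeight b w)) ((specIdeal (a + b) p e).map (factorHom (a + b) a b τ)) *
      qProd a * qProd b = hilb w (Ideal.span {e}) * qProd (b + a) := by
  have h := hilb_factorHom rfl hw (specIdeal (a + b) p e)
  rw [hilb_specIdeal hp hn hpw] at h
  have h1 : qProd a = (∏ k ∈ Finset.range a, ∑ j ∈ Finset.range (k + 1), PowerSeries.X ^ j) *
      (1 - PowerSeries.X) ^ a := by
    simp only [qProd, ← sum_range_X_pow_mul]
    rw [Finset.prod_mul_distrib, Finset.prod_const, Finset.card_range]
  have h2 : qProd (b + a) = qProd b *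
      (∏ k ∈ Finset.range a, ∑ j ∈ Finset.range (b + k + 1), PowerSeries.X ^ j) *
      (1 - PowerSeries.X) ^ a := by
    rw [qProd, Finset.prod_range_add, qProd, mul_assoc]
    simp only [← sum_range_X_pow_mul]
    rw [Finset.prod_mul_distrib, Finset.prod_mul_distrib, Finset.prod_const, Finset.prod_const,
      Finset.card_range, Finset.card_range, mul_assoc]
  rw [h1, h2]
  linear_combination qProd b * (1 - PowerSeries.X) ^ a * h

end Specialisation

/-! ### The Hilbert series of the level set -/

section Level

variable (c : PrymType) (g : ℕ)

/-- The coordinates of the phase space, ordered by the power of `y = x²` to which they belong. -/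
def coordEquiv : Fin g ⊕ (Fin (g + 1) ⊕ Fin (g + c.eps)) ≃ Coord c g where
  toFun := Sum.elim (fun i => .u i.rev) (Sum.elim (fun i => .w i.rev) (fun i => .v i.rev))
  invFun
    | .u j => Sum.inl j.rev
    | .v j => Sum.inr (Sum.inr j.rev)
    | .w j => Sum.inr (Sum.inl j.rev)
  left_inv := by rintro (_ | _ | _) <;> simp
  right_inv := by rintro (_ | _ | _) <;> simp

/-- The polynomial `V` in `y = x²` such that `v(x)` is `x V(x²)` in case (I) and `V(x²)` in
case (II). -/
def vGen (m : ℕ) : (MvPolynomial (Fin m) ℂ)[X] := ∑ i : Fin m, C (MvPolynomial.X i) * X ^ (i : ℕ)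

/-- `y V²` in case (I), and `(V² - V(0)²) / y` in case (II). -/
def sqPart {A : Type} [CommRing A] (V : A[X]) : A[X] :=
  match c with
    | .I => X * V ^ 2
    | .II => divX (V ^ 2)

/-- `0` in case (I), and `V(0)²` in case (II). -/
def sqConst {A : Type} [CommRing A] (V : A[X]) : A :=
  match c with
    | .I => 0
    | .II => (V ^ 2).coeff 0

/-- The right-hand side is `v(x)²` written in `y = x²`. In case (II) the product `u w` carries a
factor `y`, so `V²` is split into a multiple of `y` and its constant term. -/
lemma sqPart_rel {A : Type} [CommRing A] (V : A[X]) :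
    X ^ c.eps * sqPart c V + C (sqConst c V) = X ^ (1 - c.eps) * V ^ 2 := by
  cases c with
  | I => simp [sqPart, sqConst, PrymType.eps]
  | II => simp [sqPart, sqConst, PrymType.eps]

lemma map_sqPart {A B : Type} [CommRing A] [CommRing B] (φ : A →+* B) (V : A[X]) :
    (sqPart c V).map φ = sqPart c (V.map φ) := by
  cases c with
  | I => simp [sqPart]
  | II =>
    ext n
    simp only [sqPart, ← Polynomial.map_pow, coeff_divX, coeff_map]

lemma map_sqConst {A B : Type} [CommRing A] [CommRing B] (φ : A →+* B) (V : A[X]) :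
    φ (sqConst c V) = sqConst c (V.map φ) := by
  cases c with
  | I => simp [sqConst]
  | II => simp only [sqConst, ← Polynomial.map_pow, coeff_map]

lemma coeffIdeal_rel {A : Type} [CommRing A] (p V : A[X]) :
    coeffIdeal (X ^ c.eps * p + C (sqConst c V)) = coeffIdeal p ⊔ Ideal.span {sqConst c V} := by
  cases c with
  | I => simp [sqConst, PrymType.eps]
  | II =>
    rw [← coeffIdeal_X_mul_add_C]
    simp [PrymType.eps]

/-- The polynomial `P` in `y = x²` such that the relations of the level set over `f₀` amount to
`U W = P`, where `u(x) = U(x²)`, `w(x) = W(x²)` in case (I) and `u(x) = x U(x²)`, `w(x) = x W(x²)` in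
case (II), and to a relation for the lowest coefficient in case (II). -/
def targetPoly : (MvPolynomial (Fin (g + c.eps)) ℂ)[X] :=
  X ^ (g + (g + 1)) - sqPart c (vGen (g + c.eps))

/-- The weights of the coefficients of `V`. -/
def vWeight (m : ℕ) : Fin m → ℕ := fun i => m - i

lemma vWeight_ne_zero (m : ℕ) (i : Fin m) : vWeight m i ≠ 0 := by
  simp only [vWeight]
  omega

lemma isHomogPoly_vGen (m : ℕ) : IsHomogPoly (vWeight m) m (vGen m) :=
  IsHomogPoly.sum fun i => by
    have := IsHomogPoly.C_mul_X_pow (m := i)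
      (MvPolynomial.isWeightedHomogeneous_X ℂ (vWeight m) i)
    rwa [show (i : ℕ) + vWeight m i = m by simp only [vWeight]; omega] at this

/-- The degree `2g + 1` arises as `2g + 1` from `y V²` in case (I), and as `2(g + 1) - 1` after
division by `y` in case (II). -/
lemma IsHomogPoly.sqPart {σ : Type} {w : σ → ℕ} {V : (MvPolynomial σ ℂ)[X]}
    (hV : IsHomogPoly w (g + c.eps) V) : IsHomogPoly w (g + (g + 1)) (sqPart c V) := by
  have hV2 := hV.mul hV
  rw [← sq] at hV2
  cases c with
  | I =>
    have := (IsHomogPoly.X_pow w 1).mul hV2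
    rw [pow_one] at this
    simpa only [HyperellipticPrym.sqPart, PrymType.eps, add_zero,
      show 1 + (g + g) = g + (g + 1) by ring] using this
  | II =>
    refine ⟨fun i j hij => ?_, fun i hi => ?_⟩
    · rw [HyperellipticPrym.sqPart, coeff_divX]
      exact hV2.1 _ _ (by simp only [PrymType.eps]; omega)
    · rw [HyperellipticPrym.sqPart, coeff_divX]
      exact hV2.2 _ (by simp only [PrymType.eps]; omega)

lemma isHomogPoly_targetPoly :
    IsHomogPoly (vWeight (g + c.eps)) (g + (g + 1)) (targetPoly c g) :=
  (IsHomogPoly.X_pow _ _).sub (IsHomogPoly.sqPart c g (isHomogPoly_vGen _))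

/-- The degree of `V` is less than the number of its coefficients; so the square does not disturb
the leading term of `targetPoly`. -/
lemma degree_sqPart_vGen : (sqPart c (vGen (g + c.eps))).degree < ((g + (g + 1) : ℕ) : WithBot ℕ) := by
  -- For `m = 0`, which is case (I) with `g = 0`, the strict bound on `natDegree` fails, but `V`
  -- vanishes.
  have h : ∀ m, m = 0 ∧ vGen m = 0 ∨ 0 < m ∧ (vGen m).natDegree < m := by
    intro m
    rcases Nat.eq_zero_or_pos m with rfl | hm
    · exact Or.inl ⟨rfl, by simp [vGen]⟩
    · refine Or.inr ⟨hm, ?_⟩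
      have h1 := degree_sum_fin_lt fun i : Fin m => (MvPolynomial.X i : MvPolynomial (Fin m) ℂ)
      rcases eq_or_ne (vGen m) 0 with h0 | h0
      · rwa [h0, natDegree_zero]
      · exact (natDegree_lt_iff_degree_lt h0).2 h1
  rw [degree_lt_iff_coeff_zero]
  intro i hi
  rcases h (g + c.eps) with ⟨h0, h1⟩ | ⟨h0, h1⟩
  · rw [h1]
    cases c <;> simp [sqPart]
  · have h2 : (vGen (g + c.eps) ^ 2).natDegree ≤ 2 * (vGen (g + c.eps)).natDegree :=
      natDegree_pow_le
    cases c with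
    | I =>
      obtain ⟨k, rfl⟩ : ∃ k, i = k + 1 := ⟨i - 1, by omega⟩
      rw [sqPart, coeff_X_mul, coeff_eq_zero_of_natDegree_lt]
      simp only [PrymType.eps] at *
      omega
    | II =>
      rw [sqPart, coeff_divX, coeff_eq_zero_of_natDegree_lt]
      simp only [PrymType.eps] at *
      omega

lemma targetPoly_monic : (targetPoly c g).Monic :=
  monic_X_pow_sub (degree_sqPart_vGen c g)

lemma natDegree_targetPoly : (targetPoly c g).natDegree = g + (g + 1) := by
  rw [← natDegree_X_pow (R := MvPolynomial (Fin (g + c.eps)) ℂ) (g + (g + 1))]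
  refine natDegree_eq_of_degree_eq (degree_sub_eq_left_of_degree_lt ?_)
  rw [degree_X_pow]
  exact degree_sqPart_vGen c g

/-! ### The level set as a base change of the ring of factorizations -/

/-- The isomorphism with the phase ring that is given by the ordering of the coordinates. -/
def coordAlgEquiv : MvPolynomial (Fin g ⊕ (Fin (g + 1) ⊕ Fin (g + c.eps))) ℂ ≃ₐ[ℂ] PhaseRing c g :=
  MvPolynomial.renameEquiv ℂ (coordEquiv c g)

/-- The coordinates are numbered from the highest power of `x` downwards, the generic coefficients
by the power of `y`; hence the reversal. -/
lemma expand_sum_rev {A : Type} [CommRing A] (m e : ℕ) (f : Fin m → A) :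
    expand A 2 (∑ i : Fin m, C (f i.rev) * X ^ (i : ℕ)) * X ^ e
      = ∑ j : Fin m, C (f j) * X ^ (2 * (m - (j + 1)) + e) := by
  rw [map_sum, Finset.sum_mul, ← Equiv.sum_comp Fin.revPerm]
  refine Finset.sum_congr rfl fun i _ => ?_
  rw [map_mul, map_pow, expand_C, expand_X, Fin.revPerm_apply, Fin.rev_rev, Fin.val_rev, pow_add,
    pow_mul, mul_assoc]

lemma expand_monicOf_rev {A : Type} [CommRing A] (m e : ℕ) (f : Fin m → A) :
    expand A 2 (monicOf fun i : Fin m => f i.rev) * X ^ e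
      = X ^ (2 * m + e) + ∑ j : Fin m, C (f j) * X ^ (2 * (m - (j + 1)) + e) := by
  rw [monicOf, map_add, add_mul, expand_sum_rev, map_pow, expand_X, pow_add, pow_mul]

lemma uPoly_eq : uPoly c g = expand _ 2 (monicOf fun i : Fin g =>
    (MvPolynomial.X (Coord.u i.rev) : PhaseRing c g)) * X ^ c.eps :=
  (expand_monicOf_rev g c.eps fun j => (MvPolynomial.X (Coord.u j) : PhaseRing c g)).symm

lemma wPoly_eq : wPoly c g = expand _ 2 (monicOf fun i : Fin (g + 1) =>
    (MvPolynomial.X (Coord.w i.rev) : PhaseRing c g)) * X ^ c.eps :=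
  (expand_monicOf_rev (g + 1) c.eps fun j => (MvPolynomial.X (Coord.w j) : PhaseRing c g)).symm

lemma vPoly_eq : vPoly c g = expand _ 2 (∑ i : Fin (g + c.eps),
    C (MvPolynomial.X (Coord.v i.rev) : PhaseRing c g) * X ^ (i : ℕ)) * X ^ (1 - c.eps) :=
  (expand_sum_rev _ _ fun j => (MvPolynomial.X (Coord.v j) : PhaseRing c g)).symm

/-- The homomorphism to the phase ring that maps the generic monic polynomial of degree `2g + 1` to
the product `U W`. -/
def levelHom : MvPolynomial (Fin (g + (g + 1)) ⊕ Fin (g + c.eps)) ℂ →ₐ[ℂ] PhaseRing c g :=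
  (coordAlgEquiv c g : _ →ₐ[ℂ] PhaseRing c g).comp (factorHom (g + (g + 1)) g (g + 1) _)

/-- The substitution `y = x²` only inserts zero coefficients, and in `y` the defining relation is `U
W = P`, with the extra relation for the constant term. Both are images under `levelHom` of relations
on the generic polynomial and `V`. -/
lemma levelIdeal_eq_map : levelIdeal c g (f₀ c g)
    = (specIdeal (g + (g + 1)) (targetPoly c g) (sqConst c (vGen _))).map (levelHom c g) := by
  set U := monicOf fun i : Fin g => (MvPolynomial.X (Coord.u i.rev) : PhaseRing c g)
  set W := monicOf fun i : Fin (g + 1) => (MvPolynomial.X (Coord.w i.rev) : PhaseRing c g)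
  set V := ∑ i : Fin (g + c.eps), C (MvPolynomial.X (Coord.v i.rev) : PhaseRing c g) * X ^ (i : ℕ)
    with hV
  have hgen : (genPoly (g + (g + 1)) (Fin (g + c.eps))).map
      (levelHom c g : MvPolynomial _ ℂ →+* PhaseRing c g) = U * W := by
    rw [levelHom, AlgHom.comp_toRingHom, ← Polynomial.map_map, map_factorHom _ rfl, prodPoly,
      genPoly, Polynomial.map_mul, map_monicOf, map_monicOf]
    simp [coordAlgEquiv, coordEquiv, U, W]
  have hcomp : (levelHom c g).comp (MvPolynomial.rename Sum.inr)
      = MvPolynomial.aeval fun i => MvPolynomial.X (Coord.v i.rev) := by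
    refine MvPolynomial.algHom_ext fun i => ?_
    simp [levelHom, factorHom, specialise_inr, coordAlgEquiv, coordEquiv]
  have hVmap : (vGen (g + c.eps)).map (((levelHom c g).comp (MvPolynomial.rename Sum.inr) :
      MvPolynomial (Fin (g + c.eps)) ℂ →ₐ[ℂ] PhaseRing c g) : _ →+* PhaseRing c g) = V := by
    rw [hcomp, vGen, Polynomial.map_sum]
    simp [hV]
  have hrel : uPoly c g * wPoly c g + vPoly c g ^ 2 - (f₀ c g).map MvPolynomial.C
      = expand _ 2 (X ^ c.eps * (U * W - (X ^ (g + (g + 1)) - sqPart c V)) + C (sqConst c V)) := by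
    have h1 : X ^ c.eps * (U * W - (X ^ (g + (g + 1)) - sqPart c V)) + C (sqConst c V)
        = X ^ c.eps * (U * W) + X ^ (1 - c.eps) * V ^ 2 - X ^ (c.eps + (g + (g + 1))) := by
      rw [← sqPart_rel, pow_add]
      ring
    -- The exponents are `4g + 2 = 2(2g + 1)` and `4g + 4 = 2(2g + 2)`, so `f₀` is the power `ε + 2g
    -- + 1` of `y`.
    have h2 : (f₀ c g).map MvPolynomial.C
        = expand (PhaseRing c g) 2 (X ^ (c.eps + (g + (g + 1)))) := by
      rw [map_pow, expand_X]
      cases c <;> simp only [f₀, PrymType.eps, Polynomial.map_pow, map_X, ← pow_mul] <;>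
        congr 1 <;> ring
    rw [h1, h2, uPoly_eq, wPoly_eq, vPoly_eq]
    simp only [map_add, map_sub, map_mul, map_pow, expand_X]
    ring
  rw [levelIdeal, hrel, ← coeffIdeal, coeffIdeal_expand, coeffIdeal_rel, specIdeal, Ideal.map_sup,
    Ideal.map_span, Set.image_singleton]
  congr 1
  · rw [← Ideal.map_coe, map_coeffIdeal, Polynomial.map_sub, hgen, Polynomial.map_map,
      ← AlgHom.comp_toRingHom, targetPoly, Polynomial.map_sub, map_sqPart, hVmap]
    simp
  · rw [← hVmap, ← map_sqConst]
    rfl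

/-- The Hilbert series of the affine ring of the level set over `f₀`. -/
def levelHilb : PowerSeries ℚ := hilb (Coord.deg (c := c) (g := g)) (levelIdeal c g (f₀ c g))

lemma levelHilb_eq : levelHilb c g = hilb (monicWeight g (monicWeight (g + 1) (vWeight (g + c.eps))))
    ((specIdeal (g + (g + 1)) (targetPoly c g) (sqConst c (vGen _))).map
      (factorHom (g + (g + 1)) g (g + 1) _)) := by
  have hdeg : ∀ x, (coordEquiv c g x).deg
      = monicWeight g (monicWeight (g + 1) (vWeight (g + c.eps))) x := by
    rintro (i | i | i) <;> simp [coordEquiv, Coord.deg, monicWeight, vWeight, Fin.val_rev] <;> omega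
  rw [levelHilb, levelIdeal_eq_map, levelHom, ← Ideal.map_mapₐ,
    ← hilb_comap (w := monicWeight g (monicWeight (g + 1) (vWeight (g + c.eps))))
      (coordAlgEquiv c g : _ →ₐ[ℂ] PhaseRing c g)
      ((coordAlgEquiv c g).symm : PhaseRing c g →ₐ[ℂ] _)]
  · congr 1
    exact Ideal.comap_map_of_bijective _ (coordAlgEquiv c g).bijective
  · intro x
    rw [← hdeg]
    simpa [coordAlgEquiv] using MvPolynomial.isWeightedHomogeneous_X ℂ Coord.deg (coordEquiv c g x)
  · intro x
    obtain ⟨x, rfl⟩ := (coordEquiv c g).surjective x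
    rw [hdeg]
    simpa [coordAlgEquiv] using MvPolynomial.isWeightedHomogeneous_X ℂ
      (monicWeight g (monicWeight (g + 1) (vWeight (g + c.eps)))) x
  · intro x
    exact (coordAlgEquiv c g).apply_symm_apply _

lemma levelHilb_mul : levelHilb c g * qProd g * qProd (g + 1)
    = hilb (vWeight (g + c.eps)) (Ideal.span {sqConst c (vGen (g + c.eps))}) *
      qProd (2 * g + 1) := by
  rw [levelHilb_eq, hilb_factorHom_specIdeal (targetPoly_monic c g) (natDegree_targetPoly c g)
    (vWeight_ne_zero _) (isHomogPoly_targetPoly c g)]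
  rw [show g + 1 + g = 2 * g + 1 by ring]

/-- No relation is left on the coefficients of `V`; they form a polynomial ring with weights `1, …,
g`. -/
theorem levelHilb_I : levelHilb .I g * qProd g * (qProd g * qProd (g + 1)) = qProd (2 * g + 1) := by
  have h : levelHilb .I g * qProd g * qProd (g + 1)
    = hilb (vWeight g) (Ideal.span {0}) * qProd (2 * g + 1) := levelHilb_mul .I g
  have h2 : hilb (vWeight g) ⊥ * qProd g = 1 := hilb_bot_fin g
  rw [Ideal.span_singleton_zero] at h
  linear_combination qProd g * h + qProd (2 * g + 1) * h2

/-- The remaining relation `V(0)² = 0` has weight `2(g + 1)`, because `V(0)` is the heaviest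
variable. It supplies the last factor `1 - q^{2g+2}` of `[2g+2]_q!`. -/
theorem levelHilb_II : levelHilb .II g * qProd g * qProd (g + 1) ^ 2 = qProd (2 * g + 2) := by
  have h : levelHilb .II g * qProd g * qProd (g + 1) = hilb (vWeight (g + 1))
    (Ideal.span {sqConst .II (vGen (g + 1))}) * qProd (2 * g + 1) := levelHilb_mul .II g
  have h2 : hilb (vWeight (g + 1)) ⊥ * qProd (g + 1) = 1 := hilb_bot_fin (g + 1)
  have h0 : sqConst .II (vGen (g + 1)) = MvPolynomial.X 0 ^ 2 := by
    simp [sqConst, vGen, coeff_zero_eq_eval_zero, eval_finsetSum, Fin.sum_univ_succ]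
  have h3 := hilb_span_singleton (vWeight_ne_zero (g + 1))
    (pow_ne_zero 2 (MvPolynomial.X_ne_zero (R := ℂ) (0 : Fin (g + 1))))
    ((MvPolynomial.isWeightedHomogeneous_X ℂ (vWeight (g + 1)) 0).pow 2)
  rw [h0, h3] at h
  have h4 : (2 • vWeight (g + 1) (0 : Fin (g + 1)) : ℕ) = 2 * g + 1 + 1 := by
    simp [vWeight]
    ring
  have h5 : qProd (2 * g + 2) = qProd (2 * g + 1) * (1 - PowerSeries.X ^ (2 * g + 1 + 1)) :=
    Finset.prod_range_succ _ _
  rw [h4] at h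
  rw [h5]
  linear_combination qProd (g + 1) * h +
    qProd (2 * g + 1) * (1 - PowerSeries.X ^ (2 * g + 1 + 1)) * h2

end Level

/-! ### The `q`-Euler characteristic -/

section Euler

variable (c : PrymType) (g : ℕ)

/-- The possible coefficients of `dt_I` in forms of degree `m`. -/
def coeffPart {k : ℕ} (m : ℤ) (I : Set.powersetCard (Fin g) k) :
    Submodule ℂ (LevelRing c g (f₀ c g)) :=
  if 0 ≤ m + ∑ i ∈ (I : Finset (Fin g)), ((i : ℤ) + 1) then
    ringPart c g (m + ∑ i ∈ (I : Finset (Fin g)), ((i : ℤ) + 1)).toNat else ⊥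

instance finite_coord : Finite (Coord c g) := Finite.of_equiv _ (coordEquiv c g)

lemma finite_ringPart (n : ℕ) : Module.Finite ℂ (ringPart c g n) :=
  finite_quotPart (by rintro (_ | _ | _) <;> exact Nat.succ_ne_zero _) _ n

lemma coeffPart_of_nonneg {k : ℕ} {m : ℤ} {I : Set.powersetCard (Fin g) k}
    (h : 0 ≤ m + ∑ i ∈ (I : Finset (Fin g)), ((i : ℤ) + 1)) : coeffPart c g m I
      = ringPart c g (m + ∑ i ∈ (I : Finset (Fin g)), ((i : ℤ) + 1)).toNat :=
  if_pos h

lemma coeffPart_of_neg {k : ℕ} {m : ℤ} {I : Set.powersetCard (Fin g) k}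
    (h : m + ∑ i ∈ (I : Finset (Fin g)), ((i : ℤ) + 1) < 0) : coeffPart c g m I = ⊥ :=
  if_neg (not_le.2 h)

lemma zero_smul_dtForm (R : Type) [CommRing R] {g k : ℕ} (φ : Fin k → Fin g) :
    (0 : R) • dtForm R φ = 0 :=
  zero_smul R _

lemma finite_coeffPart {k : ℕ} (m : ℤ) (I : Set.powersetCard (Fin g) k) :
    Module.Finite ℂ (coeffPart c g m I) := by
  rcases le_or_gt 0 (m + ∑ i ∈ (I : Finset (Fin g)), ((i : ℤ) + 1)) with h | h
  · rw [coeffPart_of_nonneg c g h]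
    exact finite_ringPart c g _
  · rw [coeffPart_of_neg c g h]
    infer_instance

/-- The form with given coefficients. -/
def formOfCoeff {k : ℕ} (m : ℤ) :
    (∀ I : Set.powersetCard (Fin g) k, coeffPart c g m I) →ₗ[ℂ]
      ⋀[LevelRing c g (f₀ c g)]^k (Fin g → LevelRing c g (f₀ c g)) where
  toFun a := ∑ I, (a I : LevelRing c g (f₀ c g)) • dtForm _ (Set.powersetCard.ofFinEmbEquiv.symm I)
  map_add' a b := by simp [add_smul, Finset.sum_add_distrib]
  map_smul' r a := by simp [Finset.smul_sum]

lemma formCoeff_formOfCoeff {k : ℕ} (m : ℤ)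
    (a : ∀ I : Set.powersetCard (Fin g) k, coeffPart c g m I) (J : Set.powersetCard (Fin g) k) :
    formCoeff (formOfCoeff c g m a) J = a J := by
  have hsum : ∀ (s : Finset (Set.powersetCard (Fin g) k))
      (f : _ → ⋀[LevelRing c g (f₀ c g)]^k (Fin g → LevelRing c g (f₀ c g))),
      formCoeff (∑ I ∈ s, f I) J = ∑ I ∈ s, formCoeff (f I) J := by
    intro s f
    simp only [formCoeff, map_sum, Finsupp.coe_finsetSum, Finset.sum_apply]
  change formCoeff (∑ I, (a I : LevelRing c g (f₀ c g)) • dtForm _ _) J = _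
  rw [hsum]
  simp only [formCoeff_smul_form]
  simp

lemma formOfCoeff_injective {k : ℕ} (m : ℤ) :
    Function.Injective (formOfCoeff c g (k := k) m) := by
  intro a b h
  funext J
  refine Subtype.ext ?_
  rw [← formCoeff_formOfCoeff, h, formCoeff_formOfCoeff]

/-- The basis forms `dt_I` are homogeneous, so a form has degree `m` exactly when each coefficient
lies in its own shifted part of `𝒜₀`. -/
lemma formPart_eq (k : ℕ) (m : ℤ) :
    formPart c g k m = LinearMap.range (formOfCoeff c g (k := k) m) := by
  refine le_antisymm (Submodule.span_le.2 ?_) ?_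
  · rintro _ ⟨n, a, I, ha, hn, rfl⟩
    have hm : m + ∑ i ∈ (I : Finset (Fin g)), ((i : ℤ) + 1) = n := by rw [← hn]; ring
    have ha' : a ∈ coeffPart c g m I := by
      rw [coeffPart, hm, if_pos (Int.natCast_nonneg n), Int.toNat_natCast]
      exact ha
    classical
    refine ⟨Pi.single I ⟨a, ha'⟩, ?_⟩
    change ∑ J, ((Pi.single I ⟨a, ha'⟩ : ∀ J, coeffPart c g m J) J : LevelRing c g (f₀ c g)) •
      dtForm _ _ = _
    rw [Finset.sum_eq_single_of_mem I (Finset.mem_univ _), Pi.single_eq_same]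
    intro J _ hJ
    rw [Pi.single_eq_of_ne hJ]
    exact zero_smul_dtForm _ _
  · rintro _ ⟨a, rfl⟩
    refine Submodule.sum_mem _ fun I _ => ?_
    rcases le_or_gt 0 (m + ∑ i ∈ (I : Finset (Fin g)), ((i : ℤ) + 1)) with h | h
    · refine Submodule.subset_span ⟨_, _, I, (coeffPart_of_nonneg c g h).le (a I).2, ?_, rfl⟩
      rw [Int.toNat_of_nonneg h]
      ring
    · have ha := (Submodule.mem_bot ℂ).1 ((coeffPart_of_neg c g h).le (a I).2)
      rw [ha]
      exact Set.mem_of_eq_of_mem (zero_smul_dtForm _ _) (zero_mem (formPart c g k m))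

lemma finrank_coeffPart {k : ℕ} (m : ℤ) (I : Set.powersetCard (Fin g) k) :
    (Module.finrank ℂ (coeffPart c g m I) : ℚ)
      = (HahnSeries.single (-∑ i ∈ (I : Finset (Fin g)), ((i : ℤ) + 1)) (1 : ℚ) *
          HahnSeries.ofPowerSeries ℤ ℚ (levelHilb c g)).coeff m := by
  have hm : m = -∑ i ∈ (I : Finset (Fin g)), ((i : ℤ) + 1) +
    (m + ∑ i ∈ (I : Finset (Fin g)), ((i : ℤ) + 1)) := by ring
  conv_rhs => rw [hm, add_comm]
  rw [HahnSeries.coeff_single_mul_add, one_mul]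
  rcases le_or_gt 0 (m + ∑ i ∈ (I : Finset (Fin g)), ((i : ℤ) + 1)) with h | h
  · rw [coeffPart_of_nonneg c g h]
    conv_rhs => rw [← Int.toNat_of_nonneg h]
    rw [HahnSeries.ofPowerSeries_apply_coeff, levelHilb, hilb, PowerSeries.coeff_mk]
    rfl
  · rw [coeffPart_of_neg c g h, finrank_bot, Nat.cast_zero, HahnSeries.ofPowerSeries_apply,
      HahnSeries.embDomain_of_notMem_range]
    rintro ⟨k, hk⟩
    simp at hk
    omega

lemma finrank_formPart (k : ℕ) (m : ℤ) : (Module.finrank ℂ (formPart c g k m) : ℚ)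
    = (∑ I : Set.powersetCard (Fin g) k,
        HahnSeries.single (-∑ i ∈ (I : Finset (Fin g)), ((i : ℤ) + 1)) (1 : ℚ) *
          HahnSeries.ofPowerSeries ℤ ℚ (levelHilb c g)).coeff m := by
  have h1 : Module.finrank ℂ (formPart c g k m)
      = Module.finrank ℂ (LinearMap.range (formOfCoeff c g (k := k) m)) := by
    rw [formPart_eq]
    rfl
  have := fun I : Set.powersetCard (Fin g) k => finite_coeffPart c g m I
  rw [h1, LinearMap.finrank_range_of_inj (formOfCoeff_injective c g m),
    Module.finrank_pi_fintype, HahnSeries.coeff_sum, Nat.cast_sum]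
  exact Finset.sum_congr rfl fun I _ => finrank_coeffPart c g m I

/-- Coefficients have nonnegative degree, and no `dt_I` lies lower than the one that involves all
indices. -/
lemma formPart_eq_bot (k : ℕ) {m : ℤ} (hm : m < -∑ i : Fin g, ((i : ℤ) + 1)) :
    formPart c g k m = ⊥ := by
  rw [formPart_eq]
  refine (Submodule.eq_bot_iff _).2 ?_
  rintro _ ⟨a, rfl⟩
  refine Finset.sum_eq_zero fun I _ => ?_
  have hI : ∑ i ∈ (I : Finset (Fin g)), ((i : ℤ) + 1) ≤ ∑ i : Fin g, ((i : ℤ) + 1) :=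
    Finset.sum_le_sum_of_subset_of_nonneg (Finset.subset_univ _) fun _ _ _ => by positivity
  have ha := (Submodule.mem_bot ℂ).1 ((coeffPart_of_neg c g (by linarith)).le (a I).2)
  rw [ha]
  exact zero_smul_dtForm _ _

theorem isFiniteType_formPart (k : ℕ) : IsFiniteType (formPart c g k) := by
  refine ⟨fun m => ?_, -∑ i : Fin g, ((i : ℤ) + 1), fun m hm => formPart_eq_bot c g k hm⟩
  have := fun I : Set.powersetCard (Fin g) k => finite_coeffPart c g m I
  rw [formPart_eq]
  exact Module.Finite.range (formOfCoeff c g (k := k) m)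

lemma ch_formPart (k : ℕ) : ch (formPart c g k) = ∑ I : Set.powersetCard (Fin g) k,
    HahnSeries.single (-∑ i ∈ (I : Finset (Fin g)), ((i : ℤ) + 1)) (1 : ℚ) *
      HahnSeries.ofPowerSeries ℤ ℚ (levelHilb c g) := by
  -- Boundedness below excludes the default value `0` of `ch`.
  have hb : BddBelow (Function.support fun m => (Module.finrank ℂ (formPart c g k m) : ℚ)) := by
    refine ⟨-∑ i : Fin g, ((i : ℤ) + 1), fun m hm => ?_⟩
    by_contra h
    refine hm ?_
    simp only
    rw [formPart_eq_bot c g k (not_le.1 h), finrank_bot, Nat.cast_zero]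
  ext m
  rw [ch, dif_pos hb, ← finrank_formPart]
  rfl

lemma single_neg_eq (n : ℕ) : HahnSeries.single (-(n : ℤ)) (1 : ℚ) = (qVar ^ n)⁻¹ := by
  rw [qVar, HahnSeries.single_pow, HahnSeries.inv_single]
  simp

/-- Each subset `I` contributes `H` times the product of `-q^{-i}` over its indices `i`, counted
from `1`. Summing over all subsets expands the product. -/
theorem qEulerChar_eq : qEulerChar (prymComplex c g (f₀ c g)) g (formPart c g)
    = (∏ i ∈ Finset.range g, (1 - (qVar ^ (i + 1))⁻¹)) *
      HahnSeries.ofPowerSeries ℤ ℚ (levelHilb c g) := by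
  have hs : ∀ s : Finset (Fin g), HahnSeries.single (-∑ i ∈ s, ((i : ℤ) + 1)) (1 : ℚ)
      = ∏ i ∈ s, (qVar ^ ((i : ℕ) + 1))⁻¹ := by
    intro s
    rw [Finset.prod_inv_distrib, Finset.prod_pow_eq_pow_sum, ← single_neg_eq]
    push_cast
    rfl
  rw [← Fin.prod_univ_eq_prod_range fun i => 1 - (qVar ^ (i + 1))⁻¹]
  -- With the negative term first, `Finset.prod_add` indexes the expansion by the set of factors in
  -- which that term is chosen, which is `I`.
  simp only [sub_eq_neg_add]
  rw [Finset.prod_add, Finset.sum_powerset, Finset.card_univ, Fintype.card_fin, qEulerChar,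
    Finset.sum_mul]
  refine Finset.sum_congr rfl fun k _ => ?_
  rw [ch_formPart, ← Finset.sum_mul, ← mul_assoc, Finset.mul_sum]
  congr 1
  rw [Finset.sum_subtype (p := fun s => s ∈ Set.powersetCard (Fin g) k) _ (by simp)]
  refine Finset.sum_congr rfl fun I _ => ?_
  rw [hs, Finset.prod_const_one, mul_one, Finset.prod_neg, I.2]

end Euler

/-! ### The closed form of the Euler characteristic -/

lemma ofPowerSeries_qProd (k : ℕ) :
    HahnSeries.ofPowerSeries ℤ ℚ (qProd k) = qFactorial qVar k := by
  rw [qProd, qFactorial, map_prod]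
  simp [qVar]

lemma qProd_ne_zero (k : ℕ) : qProd k ≠ 0 := by
  intro h
  have := congrArg PowerSeries.constantCoeff h
  simp [qProd] at this

lemma qFactorial_qVar_ne_zero (k : ℕ) : qFactorial qVar k ≠ 0 := by
  rw [← ofPowerSeries_qProd, Ne, map_eq_zero_iff _ HahnSeries.ofPowerSeries_injective]
  exact qProd_ne_zero k

lemma qVar_ne_zero : qVar ≠ 0 := HahnSeries.single_ne_zero one_ne_zero

/-- Each factor is `1 - q^{-k} = -q^{-k} (1 - q^k)`, and the exponents add up to a triangular
number. -/
lemma prod_one_sub_inv {K : Type} [Field K] {q : K} (hq : q ≠ 0) (g : ℕ) :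
    ∏ i ∈ Finset.range g, (1 - (q ^ (i + 1))⁻¹)
      = (-1) ^ g * (q ^ (g * (g + 1) / 2))⁻¹ * qFactorial q g := by
  induction g with
  | zero => simp [qFactorial]
  | succ g ih =>
    have h : (g + 1) * (g + 1 + 1) / 2 = g * (g + 1) / 2 + (g + 1) := by
      rw [show (g + 1) * (g + 1 + 1) = g * (g + 1) + (g + 1) * 2 by ring,
        Nat.add_mul_div_right _ _ two_pos]
    rw [Finset.prod_range_succ, ih, h, qFactorial, qFactorial, Finset.prod_range_succ, pow_add q]
    field_simp
    ring

/-- The `[g]_q!` contributed by the forms cancels the one in the denominator that comes from the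
coefficients of `V`. -/
theorem qEulerChar_I (g : ℕ) : qEulerChar (prymComplex .I g (f₀ .I g)) g (formPart .I g)
    = valueI qVar g := by
  have h := congrArg (HahnSeries.ofPowerSeries ℤ ℚ) (levelHilb_I g)
  simp only [map_mul, ofPowerSeries_qProd] at h
  have h1 := qFactorial_qVar_ne_zero g
  have h2 := qFactorial_qVar_ne_zero (g + 1)
  rw [qEulerChar_eq, prod_one_sub_inv qVar_ne_zero, valueI, ← h]
  field_simp

theorem qEulerChar_II (g : ℕ) : qEulerChar (prymComplex .II g (f₀ .II g)) g (formPart .II g)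
    = valueII qVar g := by
  have h := congrArg (HahnSeries.ofPowerSeries ℤ ℚ) (levelHilb_II g)
  simp only [map_mul, map_pow, ofPowerSeries_qProd] at h
  have h2 := qFactorial_qVar_ne_zero (g + 1)
  rw [qEulerChar_eq, prod_one_sub_inv qVar_ne_zero, valueII, ← h]
  field_simp

/-! ### The limit `q → 1` -/

/-- Extracts the zero at `q = 1`; the cofactor is continuous there with value `k!`. -/
lemma qFactorial_eq {K : Type} [Field K] (q : K) (k : ℕ) : qFactorial q k
    = (∏ i ∈ Finset.range k, ∑ j ∈ Finset.range (i + 1), q ^ j) * (1 - q) ^ k := by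
  rw [qFactorial]
  simp only [← geom_sum_mul_neg]
  rw [Finset.prod_mul_distrib, Finset.prod_const, Finset.card_range]

lemma tendsto_prod_geom_sum (k : ℕ) : Filter.Tendsto
    (fun q : ℂ => ∏ i ∈ Finset.range k, ∑ j ∈ Finset.range (i + 1), q ^ j) (nhdsWithin 1 {1}ᶜ)
    (nhds (k.factorial : ℂ)) := by
  have hc : Continuous fun q : ℂ => ∏ i ∈ Finset.range k, ∑ j ∈ Finset.range (i + 1), q ^ j := by
    fun_prop
  have := (hc.tendsto 1).mono_left (nhdsWithin_le_nhds (s := {1}ᶜ))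
  simpa [← Finset.prod_range_add_one_eq_factorial] using this

lemma tendsto_qBinomial (a b : ℕ) : Filter.Tendsto
    (fun q : ℂ => qFactorial q (a + b) / (qFactorial q a * qFactorial q b)) (nhdsWithin 1 {1}ᶜ)
    (nhds ((a + b).choose a : ℂ)) := by
  have h := (tendsto_prod_geom_sum (a + b)).div
    ((tendsto_prod_geom_sum a).mul (tendsto_prod_geom_sum b))
    (mul_ne_zero (Nat.cast_ne_zero.2 a.factorial_ne_zero) (Nat.cast_ne_zero.2 b.factorial_ne_zero))
  rw [Nat.cast_add_choose]
  -- Away from `q = 1` the powers `(1 - q)^(a + b)` in numerator and denominator cancel.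
  refine h.congr' ?_
  filter_upwards [self_mem_nhdsWithin] with q hq
  have hq' : 1 - q ≠ 0 := sub_ne_zero.2 (Ne.symm hq)
  rw [qFactorial_eq q (a + b), qFactorial_eq q a, qFactorial_eq q b, pow_add, mul_mul_mul_comm]
  exact (mul_div_mul_right _ _ (mul_ne_zero (pow_ne_zero _ hq') (pow_ne_zero _ hq'))).symm

lemma tendsto_sign_pow (g m : ℕ) : Filter.Tendsto
    (fun q : ℂ => (-1) ^ g * (q ^ m)⁻¹) (nhdsWithin 1 {1}ᶜ) (nhds ((-1) ^ g)) := by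
  have h : ContinuousAt (fun q : ℂ => (-1) ^ g * (q ^ m)⁻¹) 1 := by
    fun_prop (disch := simp)
  have := h.tendsto.mono_left (nhdsWithin_le_nhds (s := {1}ᶜ))
  simpa using this

theorem tendsto_valueI (g : ℕ) : Filter.Tendsto (fun q : ℂ => valueI q g) (nhdsWithin 1 {1}ᶜ)
    (nhds ((-1) ^ g * ((2 * g + 1).choose g : ℂ))) := by
  have h := (tendsto_sign_pow g (g * (g + 1) / 2)).mul (tendsto_qBinomial g (g + 1))
  rw [show g + (g + 1) = 2 * g + 1 by ring] at h
  exact h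

theorem tendsto_valueII (g : ℕ) : Filter.Tendsto (fun q : ℂ => valueII q g) (nhdsWithin 1 {1}ᶜ)
    (nhds ((-1) ^ g * ((2 * g + 2).choose (g + 1) : ℂ))) := by
  have h := (tendsto_sign_pow g (g * (g + 1) / 2)).mul (tendsto_qBinomial (g + 1) (g + 1))
  rw [show g + 1 + (g + 1) = 2 * g + 2 by ring] at h
  simpa only [valueII, sq] using h

end

end HyperellipticPrym

theorem mainTheorem6 (g : ℕ) :
    -- case (I)
    ((∀ k, HyperellipticPrym.IsFiniteType (HyperellipticPrym.formPart .I g k)) ∧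
      HyperellipticPrym.qEulerChar
          (HyperellipticPrym.prymComplex .I g (HyperellipticPrym.f₀ .I g)) g
          (HyperellipticPrym.formPart .I g)
        = HyperellipticPrym.valueI HyperellipticPrym.qVar g ∧
      Filter.Tendsto (fun q : ℂ => HyperellipticPrym.valueI q g) (nhdsWithin 1 {1}ᶜ)
        (nhds ((-1) ^ g * ((2 * g + 1).choose g : ℂ)))) ∧
    -- case (II)
    ((∀ k, HyperellipticPrym.IsFiniteType (HyperellipticPrym.formPart .II g k)) ∧
      HyperellipticPrym.qEulerChar
          (HyperellipticPrym.prymComplex .II g (HyperellipticPrym.f₀ .II g)) g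
          (HyperellipticPrym.formPart .II g)
        = HyperellipticPrym.valueII HyperellipticPrym.qVar g ∧
      Filter.Tendsto (fun q : ℂ => HyperellipticPrym.valueII q g) (nhdsWithin 1 {1}ᶜ)
        (nhds ((-1) ^ g * ((2 * g + 2).choose (g + 1) : ℂ)))) :=
  ⟨⟨HyperellipticPrym.isFiniteType_formPart .I g, HyperellipticPrym.qEulerChar_I g,
    HyperellipticPrym.tendsto_valueI g⟩,
   ⟨HyperellipticPrym.isFiniteType_formPart .II g, HyperellipticPrym.qEulerChar_II g,
    HyperellipticPrym.tendsto_valueII g⟩⟩
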